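/- Let $G$ be an undirected, connected, simple graph with node set $\{1,\dots,N\}$ and edge set $E$, $|E|=M$. Label one end of every edge as positive and the other as negative, and let $D\in\mathbb{R}^{N\times M}$ be the incidence matrix: $d_{ik}=+1$ if $i$ is the positive end of edge $k$, $d_{ik}=-1$ if $i$ is its negative end, and $d_{ik}=0$ otherwise. For $\Delta>0$ let $q(r)=\Delta\lfloor r/\Delta+1/2\rfloor$ be the uniform quantizer, applied entrywise to vectors. For $i=1,\dots,N$ let $f_i:\mathbb{R}^{n_i}\to\mathbb{R}^{n_i}$, $g_i:\mathbb{R}^{n_i}\to\mathbb{R}^{n_i\times p}$, $h_i:\mathbb{R}^{n_i}\to\mathbb{R}^p$ be locally Lipschitz, with $f_i(0)=0$, $h_i(0)=0$ and $g_i(0)$ of full column rank. Assume that every agent is strictly passive: there are a continuously differentiable, positive definite, radially unbounded function $S_i:\mathbb{R}^{n_i}\to\mathbb{R}_+$ and a continuous positive definite function $W_i$ such that $$\nabla S_i(\xi_i)\bigl(f_i(\xi_i)+g_i(\xi_i)u_i\bigr)\le -W_i(\xi_i)+h_i(\xi_i)^{T}u_i\qquad\text{for all }\xi_i\in\mathbb{R}^{n_i},\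 u_i\in\mathbb{R}^p .$$ Let $v\in\mathbb{R}^p$ be a constant vector, known only to one agent $\ell$, the leader; let $\Lambda_i=\Lambda_i^T>0$ be $p\times p$ matrices for $i\neq\ell$. Consider the closed-loop system with state $(x,\xi,\hat v)$, where $x_i,\hat v_i\in\mathbb{R}^p$ and $\xi_i\in\mathbb{R}^{n_i}$: $$\dot x_i=h_i(\xi_i)+\hat v_i,\qquad \dot\xi_i=f_i(\xi_i)+g_i(\xi_i)u_i\qquad(i=1,\dots,N),$$ $$\hat v_\ell= v,\qquad \dot{\hat v}_i=\Lambda_i u_i\quad(i\ne \ell),\qquad u=-(D\otimes I_p)\,q(z),\qquad z=(D^T\otimes I_p)\,x .$$ (The leader's component is treated as a constant state: $\dot{\hat v}_\ell=0$ with $\hat v_\ell(0)=v$.) A Krasowskii solution of $\dot X=F(X)$ on an interval $I$ is a (locally) absolutely continuous function $X$ on $I$ with $\dot X(t)\in\bigcap_{\delta>0}\overline{\mathrm{co}}\,F(B(X(t),\delta))$ for almost every $t\in I$. Then every Krasowskii solution $(x,\xi,\hat v)$ of this system starting at time $0$ and maximally extended forward in time is defined on $[0,\infty)$, and as $t\to\infty$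 its distance to the set $$\bigl\{(x,\xi,\hat v)\;:\;\xi=0,\ \text{every entry of } z=(D^T\otimes I_p)x \text{ lies in } [-\Delta/2,\Delta/2],\ \hat v=\mathbf 1_N\otimes v\bigr\}$$ tends to $0$. In particular, $x$ is differentiable at every $t>0$ and $\lim_{t\to+\infty}\,[\dot x(t)-\mathbf 1_N\otimes v]=0$. -/

import Mathlib

open Set Filter Topology MeasureTheory

noncomputable section

namespace QuantizedCoordination

section Krasovskii

variable {E : Type*} [NormedAddCommGroup E] [NormedSpace ℝ E]

/-- The Krasowskii regularization `⋂_{δ > 0} closure (co (F (B (X, δ))))` of a vector field. -/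
def krasovskii (F : E → E) (X : E) : Set E :=
  ⋂ δ : {δ : ℝ // 0 < δ}, closure (convexHull ℝ (F '' Metric.ball X δ.1))

/-- `X` is a Krasowskii solution of `dX/dt = F X` on the interval `I`: it is (locally) absolutely
continuous on `I`, and `dX/dt ∈ K F (X t)` for almost every `t ∈ I`. -/
def IsKrasovskiiSolutionOn (F : E → E) (X : ℝ → E) (I : Set ℝ) : Prop :=
  (∀ a b : ℝ, a ≤ b → Icc a b ⊆ I → AbsolutelyContinuousOnInterval X a b) ∧
    ∀ᵐ t : ℝ, t ∈ I → ∃ X' : E, HasDerivAt X X' t ∧ X' ∈ krasovskii F (X t)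

/-- `X`, on the interval `I ⊆ [0, ∞)` with left end `0 ∈ I`, is a forward-maximal Krasowskii
solution of `dX/dt = F X`: it has no extension to a strictly larger interval in `[0, ∞)`.
In particular every solution on `[0, ∞)` is maximal. -/
def IsMaximalKrasovskiiSolution (F : E → E) (X : ℝ → E) (I : Set ℝ) : Prop :=
  I.OrdConnected ∧ (0 : ℝ) ∈ I ∧ I ⊆ Ici 0 ∧ IsKrasovskiiSolutionOn F X I ∧
    ∀ (J : Set ℝ) (Y : ℝ → E), J.OrdConnected → J ⊆ Ici 0 → I ⊆ J →
      IsKrasovskiiSolutionOn F Y J → EqOn Y X I → J = I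

end Krasovskii

/-- The uniform quantizer `q(r) = Δ ⌊r / Δ + 1 / 2⌋`. -/
def quantizer (Δ : ℝ) (r : ℝ) : ℝ := Δ * (⌊r / Δ + 1 / 2⌋ : ℝ)

/-- The quantizer applied to every entry of a vector of `ℝ^p`. -/
def quantizerVec {p : ℕ} (Δ : ℝ) (r : EuclideanSpace ℝ (Fin p)) : EuclideanSpace ℝ (Fin p) :=
  WithLp.toLp 2 fun j => quantizer Δ (r j)

/-- A choice of a positive and a negative end for every edge of a graph. -/
structure EdgeOrientation {V : Type*} (G : SimpleGraph V) where
  pos : G.edgeSet → V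
  neg : G.edgeSet → V
  ends : ∀ e : G.edgeSet, s(pos e, neg e) = (e : Sym2 V)

/-- The incidence matrix `D` of an oriented graph. -/
def incidence {N : ℕ} {G : SimpleGraph (Fin N)} (o : EdgeOrientation G) :
    Matrix (Fin N) G.edgeSet ℝ :=
  fun i e => if i = o.pos e then 1 else if i = o.neg e then -1 else 0

/-- The relative positions `z = (Dᵀ ⊗ I_p) x`, block by block. -/
def relPos {N p : ℕ} {G : SimpleGraph (Fin N)} (o : EdgeOrientation G)
    (x : Fin N → EuclideanSpace ℝ (Fin p)) : G.edgeSet → EuclideanSpace ℝ (Fin p) :=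
  fun e => ∑ i, incidence o i e • x i

/-- The control `u = -(D ⊗ I_p) q(z)`, block by block. -/
def control {N p : ℕ} {G : SimpleGraph (Fin N)} [Fintype G.edgeSet] (o : EdgeOrientation G)
    (Δ : ℝ) (z : G.edgeSet → EuclideanSpace ℝ (Fin p)) : Fin N → EuclideanSpace ℝ (Fin p) :=
  fun i => -∑ e, incidence o i e • quantizerVec Δ (z e)

/-- The state space of the closed loop, with elements `(x, ξ, v̂)`. -/
abbrev State (N p : ℕ) (n : Fin N → ℕ) : Type :=
  (Fin N → EuclideanSpace ℝ (Fin p)) × ((i : Fin N) → EuclideanSpace ℝ (Fin (n i))) ×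
    (Fin N → EuclideanSpace ℝ (Fin p))

/-- The standing regularity of an agent `dξ/dt = f(ξ) + g(ξ) u`, `y = h(ξ)`: locally Lipschitz
maps with `f(0) = 0`, `h(0) = 0` and `g(0)` of full column rank. -/
def RegularAgent {n p : ℕ}
    (f : EuclideanSpace ℝ (Fin n) → EuclideanSpace ℝ (Fin n))
    (g : EuclideanSpace ℝ (Fin n) → (EuclideanSpace ℝ (Fin p) →L[ℝ] EuclideanSpace ℝ (Fin n)))
    (h : EuclideanSpace ℝ (Fin n) → EuclideanSpace ℝ (Fin p)) : Prop :=
  LocallyLipschitz f ∧ LocallyLipschitz g ∧ LocallyLipschitz h ∧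
    f 0 = 0 ∧ h 0 = 0 ∧ Function.Injective (g 0)

/-- Strict passivity of an agent from `u` to `y = h(ξ)`: there is a `C¹`, positive definite,
radially unbounded storage function `S` with
`∇S(ξ) (f(ξ) + g(ξ) u) ≤ -W(ξ) + h(ξ)ᵀ u`, where `W` is continuous and positive definite. -/
def StrictlyPassive {n p : ℕ}
    (f : EuclideanSpace ℝ (Fin n) → EuclideanSpace ℝ (Fin n))
    (g : EuclideanSpace ℝ (Fin n) → (EuclideanSpace ℝ (Fin p) →L[ℝ] EuclideanSpace ℝ (Fin n)))
    (h : EuclideanSpace ℝ (Fin n) → EuclideanSpace ℝ (Fin p)) : Prop :=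
  ∃ S W : EuclideanSpace ℝ (Fin n) → ℝ,
    ContDiff ℝ 1 S ∧ S 0 = 0 ∧ (∀ ξ, ξ ≠ 0 → 0 < S ξ) ∧
    Tendsto S (cocompact (EuclideanSpace ℝ (Fin n))) atTop ∧
    Continuous W ∧ W 0 = 0 ∧ (∀ ξ, ξ ≠ 0 → 0 < W ξ) ∧
    ∀ (ξ : EuclideanSpace ℝ (Fin n)) (u : EuclideanSpace ℝ (Fin p)),
      fderiv ℝ S ξ (f ξ + g ξ u) ≤ -W ξ + inner ℝ (h ξ) u

/-- The right-hand side of the closed loop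
`dx_i/dt = h_i(ξ_i) + v̂_i`, `dξ_i/dt = f_i(ξ_i) + g_i(ξ_i) u_i`, and `dv̂_i/dt = Λ_i u_i` for
`i ≠ leader`, with `u = -(D ⊗ I_p) q(z)` and `z = (Dᵀ ⊗ I_p) x`.
The leader does not update `v̂_leader`, which is constant. -/
def closedLoop {N p : ℕ} {n : Fin N → ℕ} {G : SimpleGraph (Fin N)} [Fintype G.edgeSet]
    (o : EdgeOrientation G) (leader : Fin N) (Δ : ℝ)
    (f : (i : Fin N) → EuclideanSpace ℝ (Fin (n i)) → EuclideanSpace ℝ (Fin (n i)))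
    (g : (i : Fin N) → EuclideanSpace ℝ (Fin (n i)) →
      (EuclideanSpace ℝ (Fin p) →L[ℝ] EuclideanSpace ℝ (Fin (n i))))
    (h : (i : Fin N) → EuclideanSpace ℝ (Fin (n i)) → EuclideanSpace ℝ (Fin p))
    (Λ : Fin N → Matrix (Fin p) (Fin p) ℝ) (X : State N p n) : State N p n :=
  (fun i => h i (X.2.1 i) + X.2.2 i,
   fun i => f i (X.2.1 i) + g i (X.2.1 i) (control o Δ (relPos o X.1) i),
   fun i => if i = leader then 0
     else Matrix.toEuclideanLin (Λ i) (control o Δ (relPos o X.1) i))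

/-- The set where `ξ = 0`, every entry of `z = (Dᵀ ⊗ I_p) x` lies in `[-Δ/2, Δ/2]`, and
`v̂ = 1 ⊗ v`. -/
def targetSet {N p : ℕ} (n : Fin N → ℕ) {G : SimpleGraph (Fin N)}
    (o : EdgeOrientation G) (Δ : ℝ) (v : EuclideanSpace ℝ (Fin p)) : Set (State N p n) :=
  {X | X.2.1 = 0 ∧ (∀ e j, relPos o X.1 e j ∈ Icc (-(Δ / 2)) (Δ / 2)) ∧ X.2.2 = fun _ => v}

end QuantizedCoordination

end

/-! The quantizer is discontinuous but monotone, so it has a convex potential `Q`, and its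
Krasowskii values at `z` are subgradients of `Q` at `z`. Hence the chain rule holds along solutions
at almost every time, whichever subgradient the solution follows. With `A i` the inverse of `Λ i`
(the identity for the leader), the energy `∑ Q(z) + ∑ S_i(ξ_i) + ½ ∑ ⟪A_i (v̂_i - v), v̂_i - v⟫`
decreases at least at the rate `∑ W_i(ξ_i)`: by the adjointness of `D` and `Dᵀ` the power of the
couplings cancels the supply rates of passivity and the adaptation terms, and `v` drops out because
the columns of `D` sum to zero. The energy bounds `z`, `ξ` and `v̂`, though not `x`. The velocity
therefore stays bounded, the solution is Lipschitz, and a local existence theorem continues it past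
any finite end time.

The limit is identified by estimates on time windows in place of an invariance principle. The
decrease of energy forces `ξ → 0`, since a Lipschitz `ξ` away from zero would dissipate a fixed
amount (`tendsto_agents`). The combination `ξ_i - g_i(0) A_i v̂_i` has derivative `f_i(ξ_i) +
(g_i(ξ_i) - g_i(0)) u_i → 0`, and `g_i(0)` is injective, so `v̂` is nearly constant on windows of
fixed length (`eventually_norm_velocity_sub_le`). On a long window `z` drifts with nearly constant
velocity `Dᵀ v̂`; as `z` is bounded, `Dᵀ v̂ → 0`, and connectedness with the leader's value gives
`v̂ → 1 ⊗ v` (`tendsto_velocity`). Finally, `v̂` is almost still while `A_i` times its derivative is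
`u_i`, so the mean input over a unit window is small. Paired with the almost frozen positions, this
input dominates `∑ Q(z)`, which must vanish in the limit (`eventually_couplingEnergy_le`). Smallness
of `Q(z)` places `z` near `[-Δ/2, Δ/2]`. -/

namespace QuantizedCoordination

/-! ### Growth bounds for absolutely continuous curves -/

section AbsolutelyContinuous

/-- A Lipschitz function of an absolutely continuous function is absolutely continuous. -/
theorem _root_.LipschitzOnWith.comp_absolutelyContinuousOnInterval
    {α β : Type*} [PseudoMetricSpace α] [PseudoMetricSpace β] {φ : α → β} {f : ℝ → α}
    {K : NNReal} {s : Set α} {a b : ℝ} (hφ : LipschitzOnWith K φ s)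
    (hf : AbsolutelyContinuousOnInterval f a b) (hs : MapsTo f (uIcc a b) s) :
    AbsolutelyContinuousOnInterval (fun t => φ (f t)) a b := by
  rw [absolutelyContinuousOnInterval_iff] at hf ⊢
  intro ε hε
  obtain ⟨δ, hδ, h⟩ := hf (ε / (K + 1)) (by positivity)
  refine ⟨δ, hδ, fun E hE hEδ => ?_⟩
  have h1 := h E hE hEδ
  calc _ ≤ ∑ i ∈ Finset.range E.1, K * dist (f (E.2 i).1) (f (E.2 i).2) :=
        Finset.sum_le_sum fun i hi =>
          hφ.dist_le_mul _ (hs (hE.1 i hi).1) _ (hs (hE.1 i hi).2)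
    _ = K * ∑ i ∈ Finset.range E.1, dist (f (E.2 i).1) (f (E.2 i).2) := by rw [Finset.mul_sum]
    _ ≤ K * (ε / (K + 1)) := by gcongr
    _ < (K + 1) * (ε / (K + 1)) := by gcongr; linarith
    _ = ε := by field

theorem sub_le_of_ae_hasDerivAt_le {φ : ℝ → ℝ} {a b c : ℝ} (hab : a ≤ b)
    (hφ : AbsolutelyContinuousOnInterval φ a b)
    (h : ∀ᵐ t : ℝ, t ∈ Icc a b → ∃ d, HasDerivAt φ d t ∧ d ≤ c) :
    φ b - φ a ≤ c * (b - a) := by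
  rw [← hφ.integral_deriv_eq_sub]
  have : ∫ t in a..b, deriv φ t ≤ ∫ _ in a..b, c := by
    refine intervalIntegral.integral_mono_ae_restrict hab hφ.intervalIntegrable_deriv (by simp) ?_
    rw [EventuallyLE, ae_restrict_iff' measurableSet_Icc]
    filter_upwards [h] with t ht hts
    obtain ⟨d, hd, hdc⟩ := ht hts
    rwa [hd.deriv]
  simpa [mul_comm] using this

/-- A norming functional of the increment reduces the bound to the scalar case. -/
theorem norm_sub_le_of_ae_hasDerivAt {E : Type*} [NormedAddCommGroup E] [NormedSpace ℝ E]
    {Y : ℝ → E} {a b M : ℝ} (hab : a ≤ b) (hY : AbsolutelyContinuousOnInterval Y a b)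
    (h : ∀ᵐ t : ℝ, t ∈ Icc a b → ∃ d, HasDerivAt Y d t ∧ ‖d‖ ≤ M) :
    ‖Y b - Y a‖ ≤ M * (b - a) := by
  obtain ⟨φ, hφ, hφY⟩ := exists_dual_vector'' ℝ (Y b - Y a)
  have hac : AbsolutelyContinuousOnInterval (fun t => φ (Y t)) a b :=
    (φ.lipschitz.lipschitzOnWith (s := univ)).comp_absolutelyContinuousOnInterval hY
      (mapsTo_univ _ _)
  have := sub_le_of_ae_hasDerivAt_le (c := M) hab hac (by
    filter_upwards [h] with t ht hts
    obtain ⟨d, hd, hdM⟩ := ht hts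
    refine ⟨φ d, φ.hasFDerivAt.comp_hasDerivAt t hd, ?_⟩
    calc φ d ≤ ‖φ d‖ := le_abs_self _
      _ ≤ ‖φ‖ * ‖d‖ := φ.le_opNorm d
      _ ≤ 1 * M := by gcongr
      _ = M := one_mul M)
  rw [← map_sub, hφY] at this
  exact_mod_cast this

end AbsolutelyContinuous

/-! ### Existence and continuation of Krasowskii solutions -/

section Existence

variable {E : Type*} [NormedAddCommGroup E] [NormedSpace ℝ E]

/-- The sets being intersected shrink with `δ`, so only radii below `r` matter. This permits
truncating a field outside a ball. -/
theorem krasovskii_subset_of_eqOn_ball {F G : E → E} {x : E} {r : ℝ} (hr : 0 < r)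
    (h : EqOn F G (Metric.ball x r)) : krasovskii F x ⊆ krasovskii G x := by
  intro y hy
  simp only [krasovskii, mem_iInter, Subtype.forall] at hy ⊢
  intro δ hδ
  have h1 := hy (min δ r) (lt_min hδ hr)
  rw [(h.mono (Metric.ball_subset_ball (min_le_right δ r))).image_eq] at h1
  exact closure_mono (convexHull_mono (image_mono (Metric.ball_subset_ball (min_le_left δ r)))) h1

/-- The explicit Euler scheme with step `τ`. -/
def eulerSeq (G : E → E) (x₀ : E) (τ : ℝ) : ℕ → E
  | 0 => x₀
  | k + 1 => eulerSeq G x₀ τ k + τ • G (eulerSeq G x₀ τ k)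

theorem eulerSeq_sub (G : E → E) (x₀ : E) (τ : ℝ) {j k : ℕ} (hjk : j ≤ k) :
    eulerSeq G x₀ τ k - eulerSeq G x₀ τ j
      = τ • ∑ i ∈ Finset.Ico j k, G (eulerSeq G x₀ τ i) := by
  induction k, hjk using Nat.le_induction with
  | base => simp
  | succ k hjk ih =>
    rw [Finset.sum_Ico_succ_top hjk, smul_add, ← ih, eulerSeq]
    abel

theorem norm_eulerSeq_sub_le {G : E → E} {M : ℝ} (hG : ∀ x, ‖G x‖ ≤ M) (x₀ : E) {τ : ℝ}
    (hτ : 0 ≤ τ) (j k : ℕ) :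
    ‖eulerSeq G x₀ τ k - eulerSeq G x₀ τ j‖ ≤ M * (τ * |(k : ℝ) - j|) := by
  wlog hjk : j ≤ k generalizing j k
  · rw [norm_sub_rev, abs_sub_comm]
    exact this k j (le_of_not_ge hjk)
  have hjk' : (j : ℝ) ≤ k := by exact_mod_cast hjk
  rw [eulerSeq_sub G x₀ τ hjk, norm_smul, Real.norm_of_nonneg hτ,
    abs_of_nonneg (sub_nonneg.2 hjk')]
  have : ‖∑ i ∈ Finset.Ico j k, G (eulerSeq G x₀ τ i)‖ ≤ (k - j) * M := by
    refine (norm_sum_le_of_le _ fun i _ => hG _).trans (le_of_eq ?_)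
    simp [Nat.cast_sub hjk]
  calc _ ≤ τ * ((k - j) * M) := by gcongr
    _ = _ := by ring

/-- A difference quotient of the Euler scheme is the average of the field values met on the way.
Krasowskii's convex hulls enter the existence proof here. -/
theorem smul_eulerSeq_sub_mem_convexHull {G : E → E} {x₀ : E} {τ : ℝ} (hτ : 0 < τ) {j k : ℕ}
    (hjk : j < k) {s : Set E} (hs : ∀ i ∈ Finset.Ico j k, eulerSeq G x₀ τ i ∈ s) :
    (τ * ((k : ℝ) - j))⁻¹ • (eulerSeq G x₀ τ k - eulerSeq G x₀ τ j) ∈ convexHull ℝ (G '' s) := by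
  have hjk' : (0 : ℝ) < k - j := by
    rw [sub_pos]; exact_mod_cast hjk
  rw [eulerSeq_sub G x₀ τ hjk.le, smul_smul, mul_inv, mul_comm τ⁻¹, mul_assoc,
    inv_mul_cancel₀ hτ.ne', mul_one, Finset.smul_sum]
  refine (convex_convexHull ℝ _).sum_mem (fun _ _ => by positivity) ?_
    fun i hi => subset_convexHull ℝ _ (mem_image_of_mem G (hs i hi))
  simp [Nat.cast_sub hjk.le, hjk'.ne']

theorem abs_natFloor_sub_natFloor_le (a b : ℝ) : |(⌊a⌋₊ : ℝ) - ⌊b⌋₊| ≤ |a - b| + 1 := by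
  wlog hab : b ≤ a generalizing a b
  · rw [abs_sub_comm, abs_sub_comm a b]; exact this b a (le_of_not_ge hab)
  have h1 : (⌊b⌋₊ : ℝ) ≤ ⌊a⌋₊ := by exact_mod_cast Nat.floor_mono hab
  rw [abs_of_nonneg (sub_nonneg.2 h1), abs_of_nonneg (sub_nonneg.2 hab)]
  have h2 := Nat.lt_floor_add_one b
  rcases le_total 0 a with ha | ha
  · have := Nat.floor_le ha
    linarith
  · rw [Nat.floor_of_nonpos ha, Nat.floor_of_nonpos (hab.trans ha)]
    simp only [CharP.cast_eq_zero]
    linarith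

/-- A bounded vector field has Krasowskii solutions: a pointwise ultrafilter limit of Euler
schemes. -/
theorem exists_krasovskii_solution_of_bounded [ProperSpace E] {G : E → E} {M : ℝ}
    (hG : ∀ x, ‖G x‖ ≤ M) (x₀ : E) :
    ∃ Y : ℝ → E, Y 0 = x₀ ∧ LipschitzWith M.toNNReal Y ∧
      ∀ t d, 0 < t → HasDerivAt Y d t → d ∈ krasovskii G (Y t) := by
  have hM : 0 ≤ M := (norm_nonneg _).trans (hG 0)
  set τ : ℕ → ℝ := fun m => 1 / ((m : ℝ) + 1) with hτdef
  have hτ : ∀ m, 0 < τ m := fun m => Nat.one_div_pos_of_nat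
  have hτ1 : ∀ m, τ m * (m + 1) = 1 := fun m => by
    simp only [hτdef]; field_simp
  -- Bounded sequences converge along an ultrafilter, so all times are handled at once and no
  -- subsequence has to be extracted.
  set U : Filter ℕ := Ultrafilter.toFilter (hyperfilter ℕ) with hU
  have hUle : U ≤ atTop := by
    rw [← Nat.cofinite_eq_atTop]; exact hyperfilter_le_cofinite
  have hτ0 : Tendsto τ U (𝓝 0) := tendsto_one_div_add_atTop_nhds_zero_nat.mono_left hUle
  -- The number of Euler steps completed by time `t`; the approximations are step functions of time,
  -- and equal `x₀` for `t ≤ 0`.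
  set κ : ℕ → ℝ → ℕ := fun m t => ⌊t * (m + 1)⌋₊ with hκ
  set y : ℕ → ℝ → E := fun m t => eulerSeq G x₀ (τ m) (κ m t) with hy
  have hκle : ∀ m s t, τ m * |(κ m s : ℝ) - κ m t| ≤ |s - t| + τ m := by
    intro m s t
    have h1 := abs_natFloor_sub_natFloor_le (s * (m + 1)) (t * (m + 1))
    rw [← sub_mul, abs_mul, abs_of_pos (by positivity : (0 : ℝ) < m + 1)] at h1
    calc _ ≤ τ m * (|s - t| * (m + 1) + 1) := by gcongr
      _ = |s - t| * (τ m * (m + 1)) + τ m := by ring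
      _ = _ := by rw [hτ1]; ring
  have hdist : ∀ m s t, dist (y m s) (y m t) ≤ M * (|s - t| + τ m) := by
    intro m s t
    rw [dist_eq_norm]
    exact (norm_eulerSeq_sub_le hG x₀ (hτ m).le _ _).trans (by gcongr; exact hκle m s t)
  have hy0 : ∀ m, y m 0 = x₀ := fun m => by simp [hy, hκ, eulerSeq]
  have hlim : ∀ t, ∃ z, Tendsto (fun m => y m t) U (𝓝 z) := by
    intro t
    have hmem : ∀ m, y m t ∈ Metric.closedBall x₀ (M * (|t| + 1)) := by
      intro m
      have h1 := hdist m t 0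
      rw [hy0, sub_zero] at h1
      refine Metric.mem_closedBall.2 (h1.trans ?_)
      gcongr
      simpa [hτdef] using Nat.one_div_le_one_div (α := ℝ) (Nat.zero_le m)
    obtain ⟨z, -, hz⟩ := (isCompact_closedBall x₀ (M * (|t| + 1))).ultrafilter_le_nhds'
      ((hyperfilter ℕ).map fun m => y m t)
      (Ultrafilter.mem_map.2 (Filter.univ_mem' hmem))
    exact ⟨z, hz⟩
  choose Y hY using hlim
  have hYdist : ∀ s t, dist (Y s) (Y t) ≤ M * |s - t| := by
    intro s t
    have h1 : Tendsto (fun m => M * (|s - t| + τ m)) U (𝓝 (M * (|s - t| + 0))) :=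
      (tendsto_const_nhds.add hτ0).const_mul M
    rw [add_zero] at h1
    exact le_of_tendsto_of_tendsto' ((hY s).dist (hY t)) h1 fun m => hdist m s t
  refine ⟨Y, ?_, ?_, ?_⟩
  · refine tendsto_nhds_unique (hY 0) ?_
    simp only [hy0]
    exact tendsto_const_nhds
  · refine LipschitzWith.of_dist_le_mul fun s t => ?_
    rw [Real.coe_toNNReal M hM, Real.dist_eq]
    exact hYdist s t
  · intro t d ht hd
    simp only [krasovskii, mem_iInter, Subtype.forall]
    intro δ hδ
    have hslope : Tendsto (slope Y t) (𝓝[>] t) (𝓝 d) :=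
      (hasDerivAt_iff_tendsto_slope.1 hd).mono_left
        (nhdsWithin_mono t fun s hs => ne_of_gt hs)
    -- The distance `δ` is shared by the motion during `[t, t + η]`, the discretization error `M * τ
    -- m`, and the distance from `y m t` to `Y t`.
    obtain ⟨η, hη, hMη⟩ : ∃ η : ℝ, 0 < η ∧ M * η < δ / 3 :=
      ⟨δ / 3 / (M + 1), by positivity, by
        rw [mul_div_assoc', div_lt_iff₀ (by positivity)]; nlinarith⟩
    refine isClosed_closure.mem_of_tendsto hslope ?_
    filter_upwards [Ioo_mem_nhdsGT (show t < t + η by linarith)] with s hs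
    have hκτ : ∀ r, 0 ≤ r → Tendsto (fun m => τ m * κ m r) U (𝓝 r) := by
      intro r hr
      have hbound : ∀ m, |τ m * κ m r - r| ≤ τ m := by
        intro m
        have hr' : (0 : ℝ) ≤ r * (m + 1) := by positivity
        have e1 : τ m * κ m r - r = τ m * (κ m r - r * (m + 1)) := by
          linear_combination r * hτ1 m
        rw [e1, abs_mul, abs_of_pos (hτ m)]
        have h2 : |(κ m r : ℝ) - r * (m + 1)| ≤ 1 := by
          rw [abs_le]
          constructor
          · have := Nat.lt_floor_add_one (r * ((m : ℝ) + 1))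
            simp only [hκ]; linarith
          · have := Nat.floor_le hr'
            simp only [hκ]; linarith
        nlinarith [hτ m]
      rw [tendsto_iff_norm_sub_tendsto_zero]
      exact squeeze_zero (fun _ => norm_nonneg _) hbound hτ0
    have hstep : Tendsto (fun m => τ m * ((κ m s : ℝ) - κ m t)) U (𝓝 (s - t)) := by
      simp only [mul_sub]
      exact (hκτ s (ht.le.trans hs.1.le)).sub (hκτ t ht.le)
    have hst : 0 < s - t := sub_pos.2 hs.1
    have hquot : Tendsto (fun m => (τ m * ((κ m s : ℝ) - κ m t))⁻¹ • (y m s - y m t)) U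
        (𝓝 (slope Y t s)) := by
      rw [slope_def_module]
      exact (hstep.inv₀ hst.ne').smul ((hY s).sub (hY t))
    refine isClosed_closure.mem_of_tendsto hquot ?_
    have e2 : ∀ᶠ m in U, M * τ m < δ / 3 := by
      have : Tendsto (fun m => M * τ m) U (𝓝 (M * 0)) := hτ0.const_mul M
      rw [mul_zero] at this
      exact this.eventually_lt_const (by positivity)
    filter_upwards [hstep.eventually_const_lt hst, e2,
      (hY t).eventually (Metric.ball_mem_nhds (Y t) (show 0 < δ / 3 by positivity))] with m h1 h2 h3
    have hlt : κ m t < κ m s := by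
      have := (mul_pos_iff_of_pos_left (hτ m)).1 h1
      exact_mod_cast sub_pos.1 this
    refine subset_closure (smul_eulerSeq_sub_mem_convexHull (hτ m) hlt fun i hi => ?_)
    rw [Finset.mem_Ico] at hi
    have h4 : dist (eulerSeq G x₀ (τ m) i) (y m t) ≤ M * (|s - t| + τ m) := by
      rw [dist_eq_norm]
      refine (norm_eulerSeq_sub_le hG x₀ (hτ m).le _ _).trans ?_
      gcongr
      refine le_trans ?_ (hκle m s t)
      have hi1 : (κ m t : ℝ) ≤ i := by exact_mod_cast hi.1
      have hi2 : (i : ℝ) ≤ κ m s := by exact_mod_cast hi.2.le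
      have := (hτ m).le
      rw [abs_of_nonneg (by linarith), abs_of_nonneg (by linarith)]
      gcongr
    have h5 : |s - t| ≤ η := by
      rw [abs_of_pos hst]; linarith [hs.2]
    have h6 : M * |s - t| ≤ M * η := by gcongr
    rw [Metric.mem_ball]
    calc _ ≤ dist (eulerSeq G x₀ (τ m) i) (y m t) + dist (y m t) (Y t) := dist_triangle _ _ _
      _ < δ := by linarith

/-- The field is set to zero outside the ball, which makes it bounded everywhere. Up to the time `ε`
the solution stays in the ball, where the truncation is not seen. -/
theorem exists_local_krasovskii_solution [FiniteDimensional ℝ E] {F : E → E} {x₀ : E} {R M : ℝ}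
    (hR : 0 < R) (hF : ∀ x ∈ Metric.ball x₀ R, ‖F x‖ ≤ M) :
    ∃ Y : ℝ → E, ∃ K : NNReal, ∃ ε > 0, Y 0 = x₀ ∧ LipschitzWith K Y ∧
      ∀ᵐ t : ℝ, t ∈ Ioo 0 ε → ∃ d, HasDerivAt Y d t ∧ d ∈ krasovskii F (Y t) := by
  classical
  have : ProperSpace E := FiniteDimensional.proper ℝ E
  have hM : 0 ≤ M := (norm_nonneg _).trans (hF x₀ (Metric.mem_ball_self hR))
  obtain ⟨Y, hY0, hYL, hY⟩ := exists_krasovskii_solution_of_bounded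
    (G := fun x => if x ∈ Metric.ball x₀ R then F x else 0) (M := M)
    (fun x => by
      by_cases hx : x ∈ Metric.ball x₀ R
      · simpa only [hx, if_true] using hF x hx
      · simpa only [hx, if_false, norm_zero] using hM) x₀
  obtain ⟨ε, hε, hball⟩ := Metric.continuousAt_iff.1 (hYL.continuous.continuousAt (x := 0)) R hR
  refine ⟨Y, _, ε, hε, hY0, hYL, ?_⟩
  filter_upwards [hYL.ae_differentiableAt] with t ht hts
  refine ⟨deriv Y t, ht.hasDerivAt, ?_⟩
  have hYt : Y t ∈ Metric.ball x₀ R := by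
    rw [← hY0]
    exact hball (by rw [Real.dist_eq, sub_zero, abs_of_pos hts.1]; exact hts.2)
  obtain ⟨r, hr, hrR⟩ := Metric.isOpen_iff.1 Metric.isOpen_ball _ hYt
  exact krasovskii_subset_of_eqOn_ball hr (fun x hx => if_pos (hrR hx))
    (hY t _ hts.1 ht.hasDerivAt)

/-- A maximal solution which is Lipschitz is defined on `[0, ∞)`. -/
theorem IsMaximalKrasovskiiSolution.eq_Ici [FiniteDimensional ℝ E] {F : E → E} {X : ℝ → E}
    {I : Set ℝ} (hX : IsMaximalKrasovskiiSolution F X I)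
    (hF : ∀ x, ∃ R > 0, ∃ M, ∀ y ∈ Metric.ball x R, ‖F y‖ ≤ M) {K : NNReal}
    (hK : LipschitzOnWith K X I) : I = Ici 0 := by
  obtain ⟨hconn, h0, hpos, hsol, hmax⟩ := hX
  by_cases hbdd : BddAbove I
  swap
  · refine hpos.antisymm fun t ht => ?_
    obtain ⟨s, hs, hts⟩ := not_bddAbove_iff.1 hbdd t
    exact hconn.out h0 hs ⟨ht, hts.le⟩
  exfalso
  -- The Lipschitz extension supplies an end value `Z b`, whether or not the end time `b` belongs to
  -- `I`.
  obtain ⟨Z, hZ, hZX⟩ := hK.extend_finite_dimension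
  set b := sSup I with hb
  have hIb : ∀ t ∈ I, t ≤ b := fun t ht => le_csSup hbdd ht
  have hb0 : 0 ≤ b := hIb 0 h0
  have hlt : ∀ t, 0 ≤ t → t < b → t ∈ I := by
    intro t ht htb
    obtain ⟨s, hs, hts⟩ := exists_lt_of_lt_csSup ⟨0, h0⟩ htb
    exact hconn.out h0 hs ⟨ht, hts.le⟩
  obtain ⟨R, hR, M, hM⟩ := hF (Z b)
  obtain ⟨Y, L, ε, hε, hY0, hYL, hY⟩ := exists_local_krasovskii_solution hR hM
  -- A solution started at `Z b` is glued on at time `b`; it prolongs `X` to `[0, b + ε]` and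
  -- contradicts maximality.
  set W : ℝ → E := fun t => if t < b then Z t else Y (t - b) with hW
  have hWL : LipschitzWith (max (lipschitzExtensionConstant E * K) L) W := by
    set C := max (lipschitzExtensionConstant E * K) L
    have hZC : LipschitzWith C Z := hZ.weaken (le_max_left _ _)
    have hYC : LipschitzWith C Y := hYL.weaken (le_max_right _ _)
    refine LipschitzWith.of_dist_le_mul fun s t => ?_
    wlog hst : s ≤ t generalizing s t
    · rw [dist_comm, dist_comm s]; exact this t s (le_of_not_ge hst)
    by_cases hs : s < b <;> by_cases ht : t < b
    · simpa only [hW, hs, ht, if_true] using hZC.dist_le_mul s t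
    · simp only [hW, hs, ht, if_true, if_false]
      have h1 := hZC.dist_le_mul s b
      have h2 := hYC.dist_le_mul 0 (t - b)
      rw [hY0] at h2
      refine (dist_triangle _ (Z b) _).trans ((add_le_add h1 h2).trans (le_of_eq ?_))
      rw [← mul_add]
      simp only [Real.dist_eq]
      rw [abs_of_nonpos (by linarith), abs_of_nonpos (by linarith), abs_of_nonpos (by linarith)]
      ring
    · exact absurd (hst.trans_lt ht) hs
    · simpa only [hW, hs, ht, if_false, dist_sub_right] using hYC.dist_le_mul (s - b) (t - b)
  have hsub : I ⊆ Icc 0 (b + ε) := fun t ht => ⟨hpos ht, (hIb t ht).trans (by linarith)⟩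
  have hEq : EqOn W X I := by
    intro t ht
    rcases (hIb t ht).lt_or_eq with h | h
    · simp only [hW, h, if_true]; exact (hZX ht).symm
    · simp only [hW, h, lt_irrefl, if_false, sub_self, hY0]
      rw [h] at ht; exact (hZX ht).symm
  have hJ := hmax (Icc 0 (b + ε)) W ordConnected_Icc Icc_subset_Ici_self hsub
    ⟨fun _ _ _ _ => hWL.lipschitzOnWith.absolutelyContinuousOnInterval, ?_⟩ hEq
  · have : b + ε ≤ b := hIb _ (hJ ▸ (right_mem_Icc.2 (by linarith)))
    linarith
  have hY' : ∀ᵐ t : ℝ, t - b ∈ Ioo 0 ε →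
      ∃ d, HasDerivAt Y d (t - b) ∧ d ∈ krasovskii F (Y (t - b)) :=
    (measurePreserving_sub_right volume b).quasiMeasurePreserving.ae hY
  have hne : ∀ c : ℝ, ∀ᵐ t : ℝ, t ≠ c := fun c => by
    simp [ae_iff]
  -- The ends and the junction are excluded because there `W` need not agree with a single solution
  -- on a full neighbourhood.
  filter_upwards [hsol.2, hY', hne 0, hne b, hne (b + ε)] with t h1 h2 h3 h4 h5 ht
  rcases lt_or_gt_of_ne h4 with htb | htb
  · have htI := hlt t ht.1 htb
    obtain ⟨d, hd, hdF⟩ := h1 htI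
    have hWX : W =ᶠ[𝓝 t] X := by
      filter_upwards [Ioo_mem_nhds (lt_of_le_of_ne ht.1 (Ne.symm h3)) htb] with s hs
      exact hEq (hlt s hs.1.le hs.2)
    exact ⟨d, hd.congr_of_eventuallyEq hWX, by rwa [hEq htI]⟩
  · obtain ⟨d, hd, hdF⟩ := h2 ⟨sub_pos.2 htb, by linarith [lt_of_le_of_ne ht.2 h5]⟩
    have hWY : W =ᶠ[𝓝 t] fun s => Y (s - b) := by
      filter_upwards [Ioi_mem_nhds htb] with s hs
      exact if_neg (not_lt.2 (le_of_lt (mem_Ioi.1 hs)))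
    refine ⟨d, (HasDerivAt.comp_sub_const t b hd).congr_of_eventuallyEq hWY, ?_⟩
    simpa only [hW, not_lt.2 htb.le, if_false] using hdF

end Existence

/-! ### The quantizer as the subdifferential of a convex potential -/

section Quantizer

/-- The interval between the left limit of the quantizer at `z` and its value at `z`. -/
def quantizerBox (Δ z : ℝ) : Set ℝ := Icc (Δ * ((⌈z / Δ + 1 / 2⌉ : ℝ) - 1)) (quantizer Δ z)

/-- A convex potential `∫₀ʳ q` of the quantizer. -/
noncomputable def quantizerPotential (Δ r : ℝ) : ℝ := r ^ 2 / 2 - (r - quantizer Δ r) ^ 2 / 2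

variable {Δ : ℝ}

theorem abs_sub_quantizer_le (hΔ : 0 < Δ) (r : ℝ) : |r - quantizer Δ r| ≤ Δ / 2 := by
  have h1 := Int.floor_le (r / Δ + 1 / 2)
  have h2 := Int.lt_floor_add_one (r / Δ + 1 / 2)
  have h3 : r = Δ * (r / Δ) := by field
  have h4 : r - quantizer Δ r = Δ * (r / Δ - ⌊r / Δ + 1 / 2⌋) := by
    rw [mul_sub, ← h3, quantizer]
  rw [h4, abs_mul, abs_of_pos hΔ]
  have h5 : |r / Δ - ⌊r / Δ + 1 / 2⌋| ≤ 1 / 2 := abs_le.2 ⟨by linarith, by linarith⟩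
  linarith [mul_le_mul_of_nonneg_left h5 hΔ.le]

/-- The potential is the maximum over `k` of these affine functions: `quantizer Δ r` is a multiple
of `Δ` nearest to `r`, and `Δ * k * r - (Δ * k) ^ 2 / 2 = r ^ 2 / 2 - (r - Δ * k) ^ 2 / 2`. -/
theorem le_quantizerPotential (hΔ : 0 < Δ) (r : ℝ) (k : ℤ) :
    Δ * k * r - (Δ * k) ^ 2 / 2 ≤ quantizerPotential Δ r := by
  set m := ⌊r / Δ + 1 / 2⌋ with hm
  set y := r / Δ with hy
  have h3 : r = Δ * y := by rw [hy]; field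
  have h1 : (m : ℝ) ≤ y + 1 / 2 := Int.floor_le _
  have h2 : y + 1 / 2 < m + 1 := Int.lt_floor_add_one _
  have key : (y - m) ^ 2 ≤ (y - k) ^ 2 := by
    rcases lt_trichotomy k m with h | h | h
    · have : (k : ℝ) + 1 ≤ m := by exact_mod_cast h
      nlinarith
    · rw [h]
    · have : (m : ℝ) + 1 ≤ k := by exact_mod_cast h
      nlinarith
  have hq : quantizer Δ r = Δ * m := rfl
  rw [quantizerPotential, hq, h3]
  nlinarith [mul_le_mul_of_nonneg_left key (sq_nonneg Δ)]

theorem quantizerPotential_nonneg (hΔ : 0 < Δ) (r : ℝ) : 0 ≤ quantizerPotential Δ r := by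
  simpa using le_quantizerPotential hΔ r 0

theorem quantizerPotential_zero (Δ : ℝ) : quantizerPotential Δ 0 = 0 := by
  have : ⌊(1 / 2 : ℝ)⌋ = 0 := by norm_num
  simp [quantizerPotential, quantizer, this, -one_div]

/-- These are the affine minorants for `k = 1` and `k = -1`. They give coercivity in `r`, and show
that a small potential leaves `r` close to `[-Δ/2, Δ/2]`. -/
theorem mul_abs_sub_le_quantizerPotential (hΔ : 0 < Δ) (r : ℝ) :
    Δ * (|r| - Δ / 2) ≤ quantizerPotential Δ r := by
  have h1 := le_quantizerPotential hΔ r 1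
  have h2 := le_quantizerPotential hΔ r (-1)
  push_cast at h1 h2
  rcases abs_cases r with h | h <;> rw [h.1] <;> linarith

/-- Upper semicontinuity: all values near `z` lie in one box, fixed by `z`. -/
theorem eventually_quantizer_mem_quantizerBox (hΔ : 0 < Δ) (z : ℝ) :
    ∀ᶠ y in 𝓝 z, quantizer Δ y ∈ quantizerBox Δ z := by
  have hc : Tendsto (fun y : ℝ => y / Δ + 1 / 2) (𝓝 z) (𝓝 (z / Δ + 1 / 2)) :=
    Continuous.tendsto (by fun_prop) z
  have h1 : ((⌈z / Δ + 1 / 2⌉ : ℝ) - 1) < z / Δ + 1 / 2 := by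
    linarith [Int.ceil_lt_add_one (z / Δ + 1 / 2)]
  filter_upwards [hc.eventually_const_lt h1,
    hc.eventually_lt_const (Int.lt_floor_add_one (z / Δ + 1 / 2))] with y hy1 hy2
  refine ⟨mul_le_mul_of_nonneg_left ?_ hΔ.le, mul_le_mul_of_nonneg_left ?_ hΔ.le⟩
  · have : ⌈z / Δ + 1 / 2⌉ - 1 ≤ ⌊y / Δ + 1 / 2⌋ := Int.le_floor.2 (by push_cast; exact hy1.le)
    exact_mod_cast this
  · have : ⌊y / Δ + 1 / 2⌋ < ⌊z / Δ + 1 / 2⌋ + 1 := Int.floor_lt.2 (by push_cast; exact hy2)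
    exact_mod_cast Int.lt_add_one_iff.1 this

theorem quantizer_mem_quantizerBox (hΔ : 0 < Δ) (z : ℝ) : quantizer Δ z ∈ quantizerBox Δ z :=
  (eventually_quantizer_mem_quantizerBox hΔ z).self_of_nhds

theorem abs_le_of_mem_quantizerBox (hΔ : 0 < Δ) {z w : ℝ} (hw : w ∈ quantizerBox Δ z) :
    |w| ≤ |z| + Δ / 2 := by
  have h1 := abs_le.1 (abs_sub_quantizer_le hΔ z)
  have h2 : z - Δ / 2 ≤ Δ * ((⌈z / Δ + 1 / 2⌉ : ℝ) - 1) := by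
    have := mul_le_mul_of_nonneg_left (Int.le_ceil (z / Δ + 1 / 2)) hΔ.le
    have h3 : z = Δ * (z / Δ) := by field
    linarith
  have h4 := hw.1
  have h5 := hw.2
  rw [abs_le]
  constructor
  · linarith [neg_abs_le z]
  · linarith [le_abs_self z]

/-- The elements of `quantizerBox Δ z` are subgradients of the potential at `z`. -/
theorem quantizerPotential_add_le (hΔ : 0 < Δ) {z w : ℝ} (hw : w ∈ quantizerBox Δ z) (r : ℝ) :
    quantizerPotential Δ z + w * (r - z) ≤ quantizerPotential Δ r := by
  have hq : ∀ s, quantizerPotential Δ s = quantizer Δ s * s - (quantizer Δ s) ^ 2 / 2 := by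
    intro s; rw [quantizerPotential]; ring
  have hR : quantizerPotential Δ z + quantizer Δ z * (r - z) ≤ quantizerPotential Δ r := by
    have := le_quantizerPotential hΔ r ⌊z / Δ + 1 / 2⌋
    rw [hq z]
    change quantizer Δ z * r - (quantizer Δ z) ^ 2 / 2 ≤ _ at this
    linarith
  set l : ℝ := Δ * ((⌈z / Δ + 1 / 2⌉ : ℝ) - 1) with hl
  have hL : quantizerPotential Δ z + l * (r - z) ≤ quantizerPotential Δ r := by
    have h1 := le_quantizerPotential hΔ r (⌈z / Δ + 1 / 2⌉ - 1)
    push_cast at h1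
    rw [← hl] at h1
    suffices quantizerPotential Δ z = l * z - l ^ 2 / 2 by linarith
    -- At a jump the one-sided values are `z ± Δ/2` and both affine functions touch the potential;
    -- elsewhere the box is a single point.
    by_cases hint : (⌊z / Δ + 1 / 2⌋ : ℝ) = z / Δ + 1 / 2
    · have h2 : ⌈z / Δ + 1 / 2⌉ = ⌊z / Δ + 1 / 2⌋ := by
        rw [← hint, Int.ceil_intCast, Int.floor_intCast]
      have h3 : quantizer Δ z = z + Δ / 2 := by
        rw [quantizer, hint]; field
      have h4 : l = z - Δ / 2 := by
        rw [hl, h2, hint]; field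
      rw [hq, h3, h4]; ring
    · have h2 : ⌈z / Δ + 1 / 2⌉ = ⌊z / Δ + 1 / 2⌋ + 1 := by
        rw [Int.ceil_eq_iff]
        push_cast
        have := lt_of_le_of_ne (Int.floor_le (z / Δ + 1 / 2)) hint
        constructor
        · linarith
        · exact (Int.lt_floor_add_one _).le
      have h3 : l = quantizer Δ z := by
        rw [hl, h2, quantizer]; push_cast; ring
      rw [hq, h3]
  -- To the right of `z` the steepest slope `quantizer Δ z` is decisive, to the left the smallest
  -- slope `l`.
  rcases le_total z r with h | h
  · have := mul_le_mul_of_nonneg_right hw.2 (sub_nonneg.2 h)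
    linarith
  · have := mul_le_mul_of_nonpos_right hw.1 (sub_nonpos.2 h)
    linarith

/-- The subgradient inequality at the point of larger potential bounds the increment by `|quantizer
Δ r| * |r - s|`. -/
theorem abs_quantizerPotential_sub_le (hΔ : 0 < Δ) {C r s : ℝ} (hr : |r| ≤ C) (hs : |s| ≤ C) :
    |quantizerPotential Δ r - quantizerPotential Δ s| ≤ (C + Δ / 2) * |r - s| := by
  wlog h : quantizerPotential Δ s ≤ quantizerPotential Δ r generalizing r s
  · rw [abs_sub_comm, abs_sub_comm r]; exact this hs hr (le_of_not_ge h)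
  rw [abs_of_nonneg (sub_nonneg.2 h)]
  have h1 := quantizerPotential_add_le hΔ (quantizer_mem_quantizerBox hΔ r) s
  have h2 := abs_le_of_mem_quantizerBox hΔ (quantizer_mem_quantizerBox hΔ r)
  calc _ ≤ quantizer Δ r * (r - s) := by linarith
    _ ≤ |quantizer Δ r| * |r - s| := (le_abs_self _).trans (abs_mul _ _).le
    _ ≤ _ := by gcongr; linarith

theorem locallyLipschitz_quantizerPotential (hΔ : 0 < Δ) :
    LocallyLipschitz (quantizerPotential Δ) := by
  intro x
  refine ⟨(|x| + 1 + Δ / 2).toNNReal, Metric.ball x 1, Metric.ball_mem_nhds x one_pos,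
    LipschitzOnWith.of_dist_le_mul fun r hr s hs => ?_⟩
  rw [Real.coe_toNNReal _ (by positivity), Real.dist_eq, Real.dist_eq]
  have hb : ∀ r ∈ Metric.ball x 1, |r| ≤ |x| + 1 := by
    intro r hr
    have h1 : |r - x| < 1 := hr
    linarith [abs_sub_abs_le_abs_sub r x]
  exact abs_quantizerPotential_sub_le hΔ (hb r hr) (hb s hs)

/-- The chain rule for the potential along a differentiable curve. -/
theorem eq_mul_of_hasDerivAt_quantizerPotential (hΔ : 0 < Δ) {z : ℝ → ℝ} {t z' d w : ℝ}
    (hz : HasDerivAt z z' t) (hd : HasDerivAt (fun s => quantizerPotential Δ (z s)) d t)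
    (hw : w ∈ quantizerBox Δ (z t)) : d = w * z' := by
  -- The potential minus its supporting line at `z t` is minimal at time `t`, so its derivative
  -- vanishes. This fixes `d` for every subgradient `w`.
  have hmin : IsLocalMin (fun s => quantizerPotential Δ (z s) - w * (z s - z t)) t := by
    refine Eventually.of_forall fun s => ?_
    have := quantizerPotential_add_le hΔ hw (z s)
    simp only [sub_self, mul_zero, sub_zero]
    linarith
  have := hmin.hasDerivAt_eq_zero (hd.sub ((hz.sub_const (z t)).const_mul w))
  linarith

end Quantizer

/-! ### Krasowskii values of the closed loop -/

section Selection

variable {N p : ℕ} {n : Fin N → ℕ} {G : SimpleGraph (Fin N)}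

theorem continuous_relPos (o : EdgeOrientation G) :
    Continuous (relPos (p := p) o) := by
  unfold relPos; fun_prop

variable [Fintype G.edgeSet]

/-- The input `-(D ⊗ I_p) w`, block by block. -/
noncomputable def edgeInput (o : EdgeOrientation G) (w : G.edgeSet → EuclideanSpace ℝ (Fin p)) :
    Fin N → EuclideanSpace ℝ (Fin p) :=
  fun i => -∑ e, incidence o i e • w e

/-- The right-hand side of the agents' dynamics with a given input. -/
noncomputable def agentField (leader : Fin N)
    (f : (i : Fin N) → EuclideanSpace ℝ (Fin (n i)) → EuclideanSpace ℝ (Fin (n i)))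
    (g : (i : Fin N) → EuclideanSpace ℝ (Fin (n i)) →
      (EuclideanSpace ℝ (Fin p) →L[ℝ] EuclideanSpace ℝ (Fin (n i))))
    (h : (i : Fin N) → EuclideanSpace ℝ (Fin (n i)) → EuclideanSpace ℝ (Fin p))
    (Λ : Fin N → Matrix (Fin p) (Fin p) ℝ) (X : State N p n)
    (u : Fin N → EuclideanSpace ℝ (Fin p)) : State N p n :=
  (fun i => h i (X.2.1 i) + X.2.2 i,
   fun i => f i (X.2.1 i) + g i (X.2.1 i) (u i),
   fun i => if i = leader then 0 else Matrix.toEuclideanLin (Λ i) (u i))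

/-- The Krasowskii values of the quantized relative positions. -/
def quantizedSelections (o : EdgeOrientation G) (Δ : ℝ)
    (x : Fin N → EuclideanSpace ℝ (Fin p)) : Set (G.edgeSet → EuclideanSpace ℝ (Fin p)) :=
  {w | ∀ e j, w e j ∈ quantizerBox Δ (relPos o x e j)}

/-- If `F y` lies in the image of a compact set `K` under `Φ y` for `y` near `x`, and `Φ x '' K`
is convex, then the Krasowskii regularization of `F` at `x` lies in `Φ x '' K`. -/
theorem krasovskii_subset_image {E H : Type*} [NormedAddCommGroup E] [NormedSpace ℝ E]
    [TopologicalSpace H] {F : E → E} {Φ : E → H → E} (hΦ : Continuous fun q : E × H => Φ q.1 q.2)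
    {K : Set H} (hK : IsCompact K) {x : E} (hconv : Convex ℝ (Φ x '' K))
    (hF : ∀ᶠ y in 𝓝 x, F y ∈ Φ y '' K) : krasovskii F x ⊆ Φ x '' K := by
  have hΦx : Continuous (Φ x) := hΦ.comp (Continuous.prodMk_right x)
  have hcl : IsClosed (Φ x '' K) := (hK.image hΦx).isClosed
  intro y hy
  rw [← hcl.closure_eq, Metric.closure_eq_iInter_cthickening]
  simp only [mem_iInter]
  intro ε hε
  have hunif : ∀ᶠ z in 𝓝 x, ∀ k ∈ K, dist (Φ z k) (Φ x k) < ε := by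
    refine hK.eventually_forall_of_forall_eventually fun k _ => ?_
    have hc : Continuous fun q : E × H => dist (Φ q.1 q.2) (Φ x q.2) :=
      hΦ.dist (hΦx.comp continuous_snd)
    exact (hc.tendsto (x, k)).eventually_lt_const (by simpa using hε)
  obtain ⟨δ, hδ, hball⟩ := Metric.eventually_nhds_iff_ball.1 (hF.and hunif)
  -- The closed thickening of a convex set is closed and convex, hence absorbs the whole closed
  -- convex hull of these values.
  have hsub : F '' Metric.ball x δ ⊆ Metric.cthickening ε (Φ x '' K) := by
    rintro _ ⟨z, hz, rfl⟩
    obtain ⟨⟨k, hk, hkz⟩, hzu⟩ := hball z hz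
    rw [← hkz]
    exact Metric.mem_cthickening_of_dist_le _ (Φ x k) _ _ (mem_image_of_mem _ hk) (hzu k hk).le
  have h1 := mem_iInter.1 hy ⟨δ, hδ⟩
  exact closure_minimal (convexHull_min hsub (hconv.cthickening ε)) Metric.isClosed_cthickening h1

theorem continuous_edgeInput (o : EdgeOrientation G) : Continuous (edgeInput (p := p) o) := by
  unfold edgeInput; fun_prop

theorem edgeInput_combo (o : EdgeOrientation G) (a b : ℝ)
    (w w' : G.edgeSet → EuclideanSpace ℝ (Fin p)) :
    edgeInput o (a • w + b • w') = a • edgeInput o w + b • edgeInput o w' := by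
  funext i
  simp only [edgeInput, Pi.add_apply, Pi.smul_apply, smul_add, Finset.sum_add_distrib, neg_add,
    smul_neg, Finset.smul_sum, smul_comm _ a, smul_comm _ b]

theorem continuous_agentField {leader : Fin N}
    {f : (i : Fin N) → EuclideanSpace ℝ (Fin (n i)) → EuclideanSpace ℝ (Fin (n i))}
    {g : (i : Fin N) → EuclideanSpace ℝ (Fin (n i)) →
      (EuclideanSpace ℝ (Fin p) →L[ℝ] EuclideanSpace ℝ (Fin (n i)))}
    {h : (i : Fin N) → EuclideanSpace ℝ (Fin (n i)) → EuclideanSpace ℝ (Fin p)}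
    {Λ : Fin N → Matrix (Fin p) (Fin p) ℝ} (hf : ∀ i, Continuous (f i))
    (hg : ∀ i, Continuous (g i)) (hh : ∀ i, Continuous (h i)) :
    Continuous fun q : State N p n × (Fin N → EuclideanSpace ℝ (Fin p)) =>
      agentField leader f g h Λ q.1 q.2 := by
  unfold agentField
  refine Continuous.prodMk (continuous_pi fun i => ?_)
    (Continuous.prodMk (continuous_pi fun i => ?_) (continuous_pi fun i => ?_))
  · have := hh i
    fun_prop
  · have h1 := hf i
    have h2 := hg i
    refine Continuous.add (by fun_prop) (Continuous.clm_apply (by fun_prop) (by fun_prop))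
  · by_cases hi : i = leader
    · simp only [hi, if_true]; exact continuous_const
    · simp only [hi, if_false]
      exact (LinearMap.continuous_of_finiteDimensional _).comp (by fun_prop)

/-- The field is jointly continuous in the state and the quantized values, and affine in the latter,
while near `X` those values stay in a compact convex box. Regularizing therefore only replaces each
quantized value by a point of its box, and one `w` serves all agents. -/
theorem exists_selection_of_mem_krasovskii (o : EdgeOrientation G) {leader : Fin N} {Δ : ℝ}
    (hΔ : 0 < Δ)
    {f : (i : Fin N) → EuclideanSpace ℝ (Fin (n i)) → EuclideanSpace ℝ (Fin (n i))}
    {g : (i : Fin N) → EuclideanSpace ℝ (Fin (n i)) →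
      (EuclideanSpace ℝ (Fin p) →L[ℝ] EuclideanSpace ℝ (Fin (n i)))}
    {h : (i : Fin N) → EuclideanSpace ℝ (Fin (n i)) → EuclideanSpace ℝ (Fin p)}
    {Λ : Fin N → Matrix (Fin p) (Fin p) ℝ} (hf : ∀ i, Continuous (f i))
    (hg : ∀ i, Continuous (g i)) (hh : ∀ i, Continuous (h i)) {X X' : State N p n}
    (hX' : X' ∈ krasovskii (closedLoop o leader Δ f g h Λ) X) :
    ∃ w ∈ quantizedSelections o Δ X.1, X' = agentField leader f g h Λ X (edgeInput o w) := by
  set toVec : (G.edgeSet → Fin p → ℝ) → G.edgeSet → EuclideanSpace ℝ (Fin p) :=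
    fun k e => WithLp.toLp 2 (k e) with htoVec
  set K : Set (G.edgeSet → Fin p → ℝ) :=
    Set.pi univ fun e => Set.pi univ fun j => quantizerBox Δ (relPos o X.1 e j) with hKdef
  have hK : IsCompact K :=
    isCompact_univ_pi fun e => isCompact_univ_pi fun j => isCompact_Icc
  have hKconv : Convex ℝ K := convex_pi fun e _ => convex_pi fun j _ => convex_Icc _ _
  have htoVecc : Continuous toVec := by
    rw [htoVec]; fun_prop
  have hΦ : Continuous fun q : State N p n × (G.edgeSet → Fin p → ℝ) =>
      agentField leader f g h Λ q.1 (edgeInput o (toVec q.2)) :=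
    (continuous_agentField hf hg hh).comp
      (continuous_fst.prodMk ((continuous_edgeInput o).comp (htoVecc.comp continuous_snd)))
  have hconv : Convex ℝ
      ((fun k => agentField leader f g h Λ X (edgeInput o (toVec k))) '' K) := by
    rintro _ ⟨k, hk, rfl⟩ _ ⟨k', hk', rfl⟩ a b ha hb hab
    refine ⟨a • k + b • k', hKconv hk hk' ha hb hab, ?_⟩
    have h1 : toVec (a • k + b • k') = a • toVec k + b • toVec k' := by
      funext e; simp [htoVec]
    simp only [h1, edgeInput_combo, agentField]
    refine Prod.ext ?_ (Prod.ext ?_ ?_)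
    · exact (Convex.combo_self hab _).symm
    · funext i
      have := (Convex.combo_self hab (f i (X.2.1 i))).symm
      simp only [Prod.snd_add, Prod.smul_snd, Prod.fst_add, Prod.smul_fst, Pi.add_apply,
        Pi.smul_apply, map_add, map_smul, smul_add]
      nth_rewrite 1 [this]
      abel
    · funext i
      simp only [Prod.snd_add, Prod.smul_snd, Pi.add_apply,
        Pi.smul_apply, map_add, map_smul]
      split_ifs <;> simp
  have hF : ∀ᶠ Y in 𝓝 X, closedLoop o leader Δ f g h Λ Y ∈
      (fun k => agentField leader f g h Λ Y (edgeInput o (toVec k))) '' K := by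
    have h1 : ∀ᶠ Y in 𝓝 X, ∀ e j,
        quantizer Δ (relPos o Y.1 e j) ∈ quantizerBox Δ (relPos o X.1 e j) := by
      refine eventually_all.2 fun e => eventually_all.2 fun j => ?_
      have hc : Continuous fun Y : State N p n => relPos o Y.1 e j := by
        have := continuous_relPos (p := p) o
        fun_prop
      exact (hc.tendsto X).eventually (eventually_quantizer_mem_quantizerBox hΔ _)
    filter_upwards [h1] with Y hY
    exact ⟨fun e j => quantizer Δ (relPos o Y.1 e j), fun e _ j _ => hY e j, rfl⟩
  obtain ⟨k, hk, hkX⟩ := krasovskii_subset_image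
    (Φ := fun Y k => agentField leader f g h Λ Y (edgeInput o (toVec k))) hΦ hK hconv hF hX'
  exact ⟨toVec k, fun e j => hk e trivial j trivial, hkX.symm⟩

end Selection

/-! ### Incidence matrix and connectedness -/

section Graph

variable {N p : ℕ} {G : SimpleGraph (Fin N)}

theorem EdgeOrientation.adj (o : EdgeOrientation G) (e : G.edgeSet) :
    G.Adj (o.pos e) (o.neg e) := by
  rw [← SimpleGraph.mem_edgeSet, o.ends]
  exact e.2

theorem relPos_apply (o : EdgeOrientation G) (x : Fin N → EuclideanSpace ℝ (Fin p))
    (e : G.edgeSet) : relPos o x e = x (o.pos e) - x (o.neg e) := by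
  have hne := (o.adj e).ne
  have h1 : ∀ i, incidence o i e • x i
      = (if i = o.pos e then x i else 0) - (if i = o.neg e then x i else 0) := by
    intro i
    by_cases h1 : i = o.pos e
    · have h2 : i ≠ o.neg e := h1 ▸ hne
      simp [incidence, h1, hne]
    · by_cases h2 : i = o.neg e <;> simp [incidence, h1, h2, hne.symm]
  simp only [relPos, h1, Finset.sum_sub_distrib, Finset.sum_ite_eq', Finset.mem_univ, if_true]

/-- `D` and `Dᵀ` are adjoint; the sign is that of the negative feedback. -/
theorem sum_inner_relPos [Fintype G.edgeSet] (o : EdgeOrientation G)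
    (w : G.edgeSet → EuclideanSpace ℝ (Fin p)) (x : Fin N → EuclideanSpace ℝ (Fin p)) :
    ∑ e, inner ℝ (w e) (relPos o x e) = -∑ i, inner ℝ (edgeInput o w i) (x i) := by
  simp only [relPos, edgeInput, inner_sum, inner_smul_right, inner_neg_left, sum_inner,
    real_inner_smul_left, Finset.sum_neg_distrib, neg_neg]
  rw [Finset.sum_comm]

/-- The columns of `D` sum to zero. Thus neither the reference velocity `v` nor a common shift of
the positions contributes to the power. -/
theorem sum_inner_edgeInput_const [Fintype G.edgeSet] (o : EdgeOrientation G)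
    (w : G.edgeSet → EuclideanSpace ℝ (Fin p)) (c : EuclideanSpace ℝ (Fin p)) :
    ∑ i, inner ℝ (edgeInput o w i) c = 0 := by
  have := sum_inner_relPos o w fun _ => c
  simp only [relPos_apply, sub_self, inner_zero_right, Finset.sum_const_zero] at this
  linarith

/-- On a connected graph the differences of node values are controlled by the edge values. -/
theorem norm_sub_le_mul_norm_relPos [Fintype G.edgeSet] (hG : G.Connected) (o : EdgeOrientation G)
    (x : Fin N → EuclideanSpace ℝ (Fin p)) (i j : Fin N) :
    ‖x i - x j‖ ≤ N * ‖relPos o x‖ := by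
  have hadj : ∀ a b, G.Adj a b → ‖x a - x b‖ ≤ ‖relPos o x‖ := by
    intro a b hab
    have h1 := norm_le_pi_norm (relPos o x) ⟨s(a, b), hab⟩
    rw [relPos_apply] at h1
    have h2 := o.ends ⟨s(a, b), hab⟩
    rcases Sym2.eq_iff.1 h2 with ⟨h3, h4⟩ | ⟨h3, h4⟩
    · rwa [h3, h4] at h1
    · rwa [h3, h4, norm_sub_rev] at h1
  obtain ⟨q, hq⟩ := (hG i j).exists_isPath
  have hw : ∀ {a b} (q : G.Walk a b), ‖x a - x b‖ ≤ q.length * ‖relPos o x‖ := by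
    intro a b q
    induction q with
    | nil => simp
    | @cons a c b hac q ih =>
      rw [SimpleGraph.Walk.length_cons]
      push_cast
      calc ‖x a - x b‖ = ‖(x a - x c) + (x c - x b)‖ := by congr 1; abel
        _ ≤ ‖x a - x c‖ + ‖x c - x b‖ := norm_add_le _ _
        _ ≤ ‖relPos o x‖ + q.length * ‖relPos o x‖ := add_le_add (hadj _ _ hac) ih
        _ = _ := by ring
  refine (hw q).trans ?_
  gcongr
  -- A path visits each node at most once, hence has fewer than `N` edges.
  have := hq.length_lt
  simpa using this.le

end Graph

/-! ### Coercive operators and norm estimates -/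

section Euclidean

theorem _root_.EuclideanSpace.norm_le_sum_abs {ι : Type*} [Fintype ι] (x : EuclideanSpace ℝ ι) :
    ‖x‖ ≤ ∑ j, |x j| := by
  rw [EuclideanSpace.norm_eq, Real.sqrt_le_iff]
  exact ⟨Finset.sum_nonneg fun _ _ => abs_nonneg _,
    Finset.sum_sq_le_sq_sum_of_nonneg fun _ _ => abs_nonneg _⟩

theorem _root_.LocallyLipschitz.finset_sum {ι α β : Type*} [PseudoEMetricSpace α]
    [SeminormedAddCommGroup β] (s : Finset ι) {φ : ι → α → β}
    (hφ : ∀ i ∈ s, LocallyLipschitz (φ i)) : LocallyLipschitz fun x => ∑ i ∈ s, φ i x := by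
  classical
  induction s using Finset.induction_on with
  | empty => simpa using LocallyLipschitz.const 0
  | insert a s ha ih =>
    simp only [Finset.sum_insert ha]
    exact (hφ a (Finset.mem_insert_self a s)).add
      (ih fun i hi => hφ i (Finset.mem_insert_of_mem hi))

/-- A positive definite operator on a finite-dimensional space is coercive. -/
theorem exists_mul_norm_sq_le_inner {H : Type*} [NormedAddCommGroup H] [InnerProductSpace ℝ H]
    [FiniteDimensional ℝ H] (A : H →L[ℝ] H) (hA : ∀ x, x ≠ 0 → 0 < inner ℝ (A x) x) :
    ∃ c > 0, ∀ x, c * ‖x‖ ^ 2 ≤ inner ℝ (A x) x := by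
  have : ProperSpace H := FiniteDimensional.proper ℝ H
  rcases (Metric.sphere (0 : H) 1).eq_empty_or_nonempty with h | h
  · refine ⟨1, one_pos, fun x => ?_⟩
    by_cases hx : x = 0
    · simp [hx]
    · exfalso
      have : (‖x‖⁻¹ • x) ∈ Metric.sphere (0 : H) 1 := by
        simp [norm_smul, hx]
      simp [h] at this
  · obtain ⟨y, hy, hmin⟩ := (isCompact_sphere (0 : H) 1).exists_isMinOn h
      (f := fun x => inner ℝ (A x) x) (by fun_prop)
    have hy1 : ‖y‖ = 1 := by simpa using hy
    have hy0 : y ≠ 0 := by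
      rintro rfl
      simp at hy1
    refine ⟨_, hA y hy0, fun x => ?_⟩
    by_cases hx : x = 0
    · simp [hx]
    · have hx' : ‖x‖ ≠ 0 := norm_ne_zero_iff.2 hx
      have h1 : (‖x‖⁻¹ • x) ∈ Metric.sphere (0 : H) 1 := by
        simp [norm_smul, hx]
      have h2 : inner ℝ (A y) y ≤ inner ℝ (A (‖x‖⁻¹ • x)) (‖x‖⁻¹ • x) := hmin h1
      rw [map_smul, real_inner_smul_left, real_inner_smul_right] at h2
      calc _ ≤ ‖x‖⁻¹ * (‖x‖⁻¹ * inner ℝ (A x) x) * ‖x‖ ^ 2 := by gcongr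
        _ = _ := by field

theorem exists_inverse_of_posDef {p : ℕ} {Λ : Matrix (Fin p) (Fin p) ℝ} (hΛ : Λ.PosDef) :
    ∃ A : EuclideanSpace ℝ (Fin p) →L[ℝ] EuclideanSpace ℝ (Fin p),
      (∀ x y, inner ℝ (A x) y = inner ℝ x (A y)) ∧ (∀ x, x ≠ 0 → 0 < inner ℝ (A x) x) ∧
      ∀ x, A (Matrix.toEuclideanLin Λ x) = x := by
  have hinv := hΛ.inv
  have hdet : IsUnit Λ.det := (Matrix.isUnit_iff_isUnit_det Λ).1 hΛ.isUnit
  refine ⟨(Matrix.toEuclideanLin Λ⁻¹).toContinuousLinearMap, ?_, ?_, ?_⟩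
  · exact Matrix.isSymmetric_toEuclideanLin_iff.2 hinv.isHermitian
  · intro x hx
    have h1 := hinv.dotProduct_mulVec_pos (x := x.ofLp) (by simpa using hx)
    rw [real_inner_comm]
    simpa [EuclideanSpace.inner_eq_star_dotProduct, dotProduct_comm] using h1
  · intro x
    ext j
    simp [Matrix.toLpLin_apply, Matrix.mulVec_mulVec, Matrix.nonsing_inv_mul _ hdet]

end Euclidean

/-! ### The energy and its decrease along solutions -/

section Lyapunov

variable {N p : ℕ} {n : Fin N → ℕ}

/-- Storage functions, dissipation rates and inverse gains for all agents; the leader has unit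
gain. -/
structure LyapunovData (leader : Fin N)
    (f : (i : Fin N) → EuclideanSpace ℝ (Fin (n i)) → EuclideanSpace ℝ (Fin (n i)))
    (g : (i : Fin N) → EuclideanSpace ℝ (Fin (n i)) →
      (EuclideanSpace ℝ (Fin p) →L[ℝ] EuclideanSpace ℝ (Fin (n i))))
    (h : (i : Fin N) → EuclideanSpace ℝ (Fin (n i)) → EuclideanSpace ℝ (Fin p))
    (Λ : Fin N → Matrix (Fin p) (Fin p) ℝ) where
  S : (i : Fin N) → EuclideanSpace ℝ (Fin (n i)) → ℝ
  W : (i : Fin N) → EuclideanSpace ℝ (Fin (n i)) → ℝ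
  A : Fin N → EuclideanSpace ℝ (Fin p) →L[ℝ] EuclideanSpace ℝ (Fin p)
  c : Fin N → ℝ
  contDiff_S : ∀ i, ContDiff ℝ 1 (S i)
  S_nonneg : ∀ i ξ, 0 ≤ S i ξ
  tendsto_S : ∀ i, Tendsto (S i) (cocompact _) atTop
  continuous_W : ∀ i, Continuous (W i)
  W_zero : ∀ i, W i 0 = 0
  W_pos : ∀ i ξ, ξ ≠ 0 → 0 < W i ξ
  passive : ∀ i ξ u, fderiv ℝ (S i) ξ (f i ξ + g i ξ u) ≤ -W i ξ + inner ℝ (h i ξ) u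
  A_symm : ∀ i x y, inner ℝ (A i x) y = inner ℝ x (A i y)
  c_pos : ∀ i, 0 < c i
  A_coercive : ∀ i x, c i * ‖x‖ ^ 2 ≤ inner ℝ (A i x) x
  A_toEuclideanLin : ∀ i, i ≠ leader → ∀ x, A i (Matrix.toEuclideanLin (Λ i) x) = x

variable {leader : Fin N}
  {f : (i : Fin N) → EuclideanSpace ℝ (Fin (n i)) → EuclideanSpace ℝ (Fin (n i))}
  {g : (i : Fin N) → EuclideanSpace ℝ (Fin (n i)) →
    (EuclideanSpace ℝ (Fin p) →L[ℝ] EuclideanSpace ℝ (Fin (n i)))}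
  {h : (i : Fin N) → EuclideanSpace ℝ (Fin (n i)) → EuclideanSpace ℝ (Fin p)}
  {Λ : Fin N → Matrix (Fin p) (Fin p) ℝ}

theorem nonempty_lyapunovData (hpass : ∀ i, StrictlyPassive (f i) (g i) (h i))
    (hΛ : ∀ i, i ≠ leader → (Λ i).PosDef) : Nonempty (LyapunovData leader f g h Λ) := by
  choose S W h1 h2 h3 h4 h5 h6 h7 h8 using hpass
  have hA : ∀ i, ∃ A : EuclideanSpace ℝ (Fin p) →L[ℝ] EuclideanSpace ℝ (Fin p),
      (∀ x y, inner ℝ (A x) y = inner ℝ x (A y)) ∧ (∀ x, x ≠ 0 → 0 < inner ℝ (A x) x) ∧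
      (i ≠ leader → ∀ x, A (Matrix.toEuclideanLin (Λ i) x) = x) := by
    intro i
    by_cases hi : i = leader
    · refine ⟨ContinuousLinearMap.id ℝ _, fun _ _ => rfl, fun x hx => ?_, fun h => absurd hi h⟩
      exact real_inner_self_pos.2 hx
    · obtain ⟨A, hA1, hA2, hA3⟩ := exists_inverse_of_posDef (hΛ i hi)
      exact ⟨A, hA1, hA2, fun _ => hA3⟩
  choose A hA1 hA2 hA3 using hA
  choose c hc1 hc2 using fun i => exists_mul_norm_sq_le_inner (A i) (hA2 i)
  refine ⟨⟨S, W, A, c, h1, fun i ξ => ?_, h4, h5, h6, h7, h8, hA1, hc1, hc2, hA3⟩⟩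
  by_cases hξ : ξ = 0
  · rw [hξ, h2]
  · exact (h3 i ξ hξ).le

variable {G : SimpleGraph (Fin N)} [Fintype G.edgeSet]

/-- The potential energy of the quantized couplings. -/
noncomputable def couplingEnergy (o : EdgeOrientation G) (Δ : ℝ)
    (x : Fin N → EuclideanSpace ℝ (Fin p)) : ℝ :=
  ∑ e, ∑ j, quantizerPotential Δ (relPos o x e j)

theorem couplingEnergy_nonneg (o : EdgeOrientation G) {Δ : ℝ} (hΔ : 0 < Δ)
    (x : Fin N → EuclideanSpace ℝ (Fin p)) : 0 ≤ couplingEnergy o Δ x :=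
  Finset.sum_nonneg fun _ _ => Finset.sum_nonneg fun _ _ => quantizerPotential_nonneg hΔ _

theorem quantizerPotential_le_couplingEnergy (o : EdgeOrientation G) {Δ : ℝ} (hΔ : 0 < Δ)
    (x : Fin N → EuclideanSpace ℝ (Fin p)) (e : G.edgeSet) (j : Fin p) :
    quantizerPotential Δ (relPos o x e j) ≤ couplingEnergy o Δ x :=
  (Finset.single_le_sum (f := fun j => quantizerPotential Δ (relPos o x e j))
    (fun _ _ => quantizerPotential_nonneg hΔ _) (Finset.mem_univ j)).trans
  (Finset.single_le_sum (f := fun e => ∑ j, quantizerPotential Δ (relPos o x e j))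
    (fun _ _ => Finset.sum_nonneg fun _ _ => quantizerPotential_nonneg hΔ _) (Finset.mem_univ e))

namespace LyapunovData

variable (D : LyapunovData leader f g h Λ) (o : EdgeOrientation G) {Δ : ℝ}
  (v : EuclideanSpace ℝ (Fin p))

/-- The storage and gain part of the Lyapunov function. -/
noncomputable def storage (X : State N p n) : ℝ :=
  ∑ i, D.S i (X.2.1 i) + (1 / 2) * ∑ i, inner ℝ (D.A i (X.2.2 i - v)) (X.2.2 i - v)

/-- The total dissipation rate. -/
noncomputable def dissipation (X : State N p n) : ℝ := ∑ i, D.W i (X.2.1 i)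

theorem W_nonneg (i : Fin N) (ξ : EuclideanSpace ℝ (Fin (n i))) : 0 ≤ D.W i ξ := by
  by_cases hξ : ξ = 0
  · rw [hξ, D.W_zero]
  · exact (D.W_pos i ξ hξ).le

theorem inner_A_nonneg (i : Fin N) (x : EuclideanSpace ℝ (Fin p)) : 0 ≤ inner ℝ (D.A i x) x :=
  (mul_nonneg (D.c_pos i).le (sq_nonneg _)).trans (D.A_coercive i x)

theorem dissipation_nonneg (X : State N p n) : 0 ≤ D.dissipation X :=
  Finset.sum_nonneg fun i _ => D.W_nonneg i _

theorem storage_nonneg (X : State N p n) : 0 ≤ D.storage v X :=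
  add_nonneg (Finset.sum_nonneg fun i _ => D.S_nonneg i _)
    (mul_nonneg (by norm_num) (Finset.sum_nonneg fun i _ => D.inner_A_nonneg i _))

theorem S_le_storage (X : State N p n) (i : Fin N) : D.S i (X.2.1 i) ≤ D.storage v X := by
  have h1 := Finset.single_le_sum (f := fun i => D.S i (X.2.1 i)) (fun i _ => D.S_nonneg i _)
    (Finset.mem_univ i)
  have h2 : 0 ≤ ∑ i, inner ℝ (D.A i (X.2.2 i - v)) (X.2.2 i - v) :=
    Finset.sum_nonneg fun i _ => D.inner_A_nonneg i _
  rw [storage]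
  linarith

theorem norm_sq_le_storage (X : State N p n) (i : Fin N) :
    D.c i / 2 * ‖X.2.2 i - v‖ ^ 2 ≤ D.storage v X := by
  have h1 : 0 ≤ ∑ i, D.S i (X.2.1 i) := Finset.sum_nonneg fun i _ => D.S_nonneg i _
  have h2 := Finset.single_le_sum (f := fun i => inner ℝ (D.A i (X.2.2 i - v)) (X.2.2 i - v))
    (fun i _ => D.inner_A_nonneg i _) (Finset.mem_univ i)
  have h3 := D.A_coercive i (X.2.2 i - v)
  rw [storage]
  linarith

theorem contDiff_storage : ContDiff ℝ 1 (D.storage v) := by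
  unfold storage
  have := D.contDiff_S
  refine ContDiff.add (ContDiff.sum fun i _ => (this i).comp
      ((ContinuousLinearMap.proj (R := ℝ)
        (φ := fun i => EuclideanSpace ℝ (Fin (n i))) i).contDiff.comp
        (contDiff_fst.comp contDiff_snd)))
    (contDiff_const.mul (ContDiff.sum fun i _ => ?_))
  exact ContDiff.inner ℝ (by fun_prop) (by fun_prop)

omit [Fintype G.edgeSet] in
theorem locallyLipschitz_quantizerPotential_relPos (hΔ : 0 < Δ) (e : G.edgeSet) (j : Fin p) :
    LocallyLipschitz fun X : State N p n => quantizerPotential Δ (relPos o X.1 e j) := by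
  refine (locallyLipschitz_quantizerPotential hΔ).comp
    (g := fun X : State N p n => relPos o X.1 e j) ?_
  refine ContDiff.locallyLipschitz (𝕂 := ℝ) ?_
  simp only [relPos_apply]
  fun_prop

theorem locallyLipschitz_energy (hΔ : 0 < Δ) :
    LocallyLipschitz fun X : State N p n => couplingEnergy o Δ X.1 + D.storage v X :=
  (LocallyLipschitz.finset_sum _ fun e _ => LocallyLipschitz.finset_sum _ fun j _ =>
    locallyLipschitz_quantizerPotential_relPos o hΔ e j).add
    (D.contDiff_storage v).locallyLipschitz

/-- The energy decreases at least at the dissipation rate along a solution. -/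
theorem exists_hasDerivAt_energy_le (hΔ : 0 < Δ) {X : ℝ → State N p n} {t : ℝ}
    {w : G.edgeSet → EuclideanSpace ℝ (Fin p)} (hw : w ∈ quantizedSelections o Δ (X t).1)
    (hX : HasDerivAt X (agentField leader f g h Λ (X t) (edgeInput o w)) t)
    (hlead : (X t).2.2 leader = v)
    (hdiff : ∀ e j, DifferentiableAt ℝ (fun s => quantizerPotential Δ (relPos o (X s).1 e j)) t) :
    ∃ d, HasDerivAt (fun s => couplingEnergy o Δ (X s).1 + D.storage v (X s)) d t ∧
      d ≤ -D.dissipation (X t) := by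
  set u := edgeInput o w with hu
  set x' : Fin N → EuclideanSpace ℝ (Fin p) := fun i => h i ((X t).2.1 i) + (X t).2.2 i with hx'
  have hx : ∀ i, HasDerivAt (fun s => (X s).1 i) (x' i) t := fun i =>
    (hasDerivAt_pi.1 ((ContinuousLinearMap.fst ℝ _ _).hasFDerivAt.comp_hasDerivAt t hX)) i
  have hsnd := (ContinuousLinearMap.snd ℝ (Fin N → EuclideanSpace ℝ (Fin p))
    (((i : Fin N) → EuclideanSpace ℝ (Fin (n i))) ×
    (Fin N → EuclideanSpace ℝ (Fin p)))).hasFDerivAt.comp_hasDerivAt t hX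
  have hξ : ∀ i, HasDerivAt (fun s => (X s).2.1 i)
      (f i ((X t).2.1 i) + g i ((X t).2.1 i) (u i)) t := fun i =>
    (hasDerivAt_pi.1 ((ContinuousLinearMap.fst ℝ _ _).hasFDerivAt.comp_hasDerivAt t hsnd)) i
  have hv : ∀ i, HasDerivAt (fun s => (X s).2.2 i)
      (if i = leader then 0 else Matrix.toEuclideanLin (Λ i) (u i)) t := fun i =>
    (hasDerivAt_pi.1 ((ContinuousLinearMap.snd ℝ _ _).hasFDerivAt.comp_hasDerivAt t hsnd)) i
  have hz : ∀ e j, HasDerivAt (fun s => relPos o (X s).1 e j) (relPos o x' e j) t := by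
    intro e j
    simp only [relPos_apply]
    exact (EuclideanSpace.proj j).hasFDerivAt.comp_hasDerivAt t ((hx (o.pos e)).sub (hx (o.neg e)))
  have hQ : HasDerivAt (fun s => couplingEnergy o Δ (X s).1)
      (∑ e, inner ℝ (w e) (relPos o x' e)) t := by
    unfold couplingEnergy
    refine HasDerivAt.fun_sum fun e _ => ?_
    have : inner ℝ (w e) (relPos o x' e) = ∑ j, w e j * relPos o x' e j := by
      simp [PiLp.inner_apply, mul_comm]
    rw [this]
    refine HasDerivAt.fun_sum fun j _ => ?_
    have hd := (hdiff e j).hasDerivAt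
    rwa [eq_mul_of_hasDerivAt_quantizerPotential hΔ (hz e j) hd (hw e j)] at hd
  have hS : HasDerivAt (fun s => ∑ i, D.S i ((X s).2.1 i))
      (∑ i, fderiv ℝ (D.S i) ((X t).2.1 i) (f i ((X t).2.1 i) + g i ((X t).2.1 i) (u i))) t :=
    HasDerivAt.fun_sum fun i _ =>
      ((D.contDiff_S i).differentiable one_ne_zero _).hasFDerivAt.comp_hasDerivAt t (hξ i)
  have hA : HasDerivAt
      (fun s => (1 / 2) * ∑ i, inner ℝ (D.A i ((X s).2.2 i - v)) ((X s).2.2 i - v))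
      (∑ i, inner ℝ ((X t).2.2 i - v) (u i)) t := by
    have : (∑ i, inner ℝ ((X t).2.2 i - v) (u i) : ℝ)
        = (1 / 2) * ∑ i, 2 * inner ℝ ((X t).2.2 i - v) (u i) := by
      rw [← Finset.mul_sum]; ring
    rw [this]
    refine (HasDerivAt.fun_sum fun i _ => ?_).const_mul _
    have h1 := (hv i).sub_const v
    have h2 : HasDerivAt (fun s => D.A i ((X s).2.2 i - v)) _ t :=
      (D.A i).hasFDerivAt.comp_hasDerivAt t h1
    refine (h2.inner ℝ h1).congr_deriv ?_
    -- The leader's estimate is frozen at `v`, so both sides vanish for it. For the others the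
    -- inverse gain cancels `Λ i`.
    by_cases hi : i = leader
    · simp [hi, hlead]
    · simp only [hi, if_false]
      rw [D.A_symm, D.A_toEuclideanLin i hi, real_inner_comm ((X t).2.2 i - v) (u i)]
      ring
  refine ⟨_, hQ.add (hS.add hA), ?_⟩
  have h1 : ∑ i, fderiv ℝ (D.S i) ((X t).2.1 i) (f i ((X t).2.1 i) + g i ((X t).2.1 i) (u i))
      ≤ ∑ i, (-D.W i ((X t).2.1 i) + inner ℝ (h i ((X t).2.1 i)) (u i)) :=
    Finset.sum_le_sum fun i _ => D.passive i _ _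
  rw [Finset.sum_add_distrib, Finset.sum_neg_distrib] at h1
  have h2 := sum_inner_relPos o w x'
  have h3 := sum_inner_edgeInput_const o w v
  rw [← hu] at h2 h3
  -- Splitting `x' = h + (v̂ - v) + v` makes the coupling power the negative of the passive supply
  -- plus the adaptation term; only the dissipation survives.
  have h4 : ∑ i, inner ℝ (u i) (x' i) = ∑ i, inner ℝ (h i ((X t).2.1 i)) (u i)
      + (∑ i, inner ℝ ((X t).2.2 i - v) (u i) + ∑ i, inner ℝ (u i) v) := by
    simp only [← Finset.sum_add_distrib]
    refine Finset.sum_congr rfl fun i _ => ?_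
    rw [real_inner_comm (u i) (h i _), real_inner_comm (u i) (_ - v), ← inner_add_right,
      ← inner_add_right, sub_add_cancel]
  rw [dissipation]
  linarith

end LyapunovData

end Lyapunov

/-! ### A priori bounds for solutions -/

section Solutions

variable {N p : ℕ} {n : Fin N → ℕ} {leader : Fin N}
  {f : (i : Fin N) → EuclideanSpace ℝ (Fin (n i)) → EuclideanSpace ℝ (Fin (n i))}
  {g : (i : Fin N) → EuclideanSpace ℝ (Fin (n i)) →
    (EuclideanSpace ℝ (Fin p) →L[ℝ] EuclideanSpace ℝ (Fin (n i)))}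
  {h : (i : Fin N) → EuclideanSpace ℝ (Fin (n i)) → EuclideanSpace ℝ (Fin p)}
  {Λ : Fin N → Matrix (Fin p) (Fin p) ℝ}
  {G : SimpleGraph (Fin N)} [Fintype G.edgeSet] {o : EdgeOrientation G} {Δ : ℝ}
  {v : EuclideanSpace ℝ (Fin p)} {X : ℝ → State N p n} {I : Set ℝ}

/-- A solution on an interval starting at `0` of the differential inclusion in which the quantized
relative positions are replaced by their Krasowskii values. -/
structure IsSelectionSolution (o : EdgeOrientation G) (leader : Fin N) (Δ : ℝ)
    (f : (i : Fin N) → EuclideanSpace ℝ (Fin (n i)) → EuclideanSpace ℝ (Fin (n i)))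
    (g : (i : Fin N) → EuclideanSpace ℝ (Fin (n i)) →
      (EuclideanSpace ℝ (Fin p) →L[ℝ] EuclideanSpace ℝ (Fin (n i))))
    (h : (i : Fin N) → EuclideanSpace ℝ (Fin (n i)) → EuclideanSpace ℝ (Fin p))
    (Λ : Fin N → Matrix (Fin p) (Fin p) ℝ) (v : EuclideanSpace ℝ (Fin p))
    (X : ℝ → State N p n) (I : Set ℝ) : Prop where
  ordConnected : I.OrdConnected
  zero_mem : (0 : ℝ) ∈ I
  subset_Ici : I ⊆ Ici 0
  ac : ∀ a b : ℝ, a ≤ b → Icc a b ⊆ I → AbsolutelyContinuousOnInterval X a b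
  ae_hasDerivAt : ∀ᵐ t : ℝ, t ∈ I → ∃ w ∈ quantizedSelections o Δ (X t).1,
    HasDerivAt X (agentField leader f g h Λ (X t) (edgeInput o w)) t
  leader_zero : (X 0).2.2 leader = v

theorem IsMaximalKrasovskiiSolution.isSelectionSolution (hΔ : 0 < Δ)
    (hf : ∀ i, Continuous (f i)) (hg : ∀ i, Continuous (g i)) (hh : ∀ i, Continuous (h i))
    (hX : IsMaximalKrasovskiiSolution (closedLoop o leader Δ f g h Λ) X I)
    (hlead : (X 0).2.2 leader = v) : IsSelectionSolution o leader Δ f g h Λ v X I where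
  ordConnected := hX.1
  zero_mem := hX.2.1
  subset_Ici := hX.2.2.1
  ac := hX.2.2.2.1.1
  ae_hasDerivAt := by
    filter_upwards [hX.2.2.2.1.2] with t ht htI
    obtain ⟨d, hd, hdK⟩ := ht htI
    obtain ⟨w, hw, rfl⟩ := exists_selection_of_mem_krasovskii o hΔ hf hg hh hdK
    exact ⟨w, hw, hd⟩
  leader_zero := hlead

/-- Bounds for the relative positions, the agents' states and the velocity estimation errors. -/
structure IsBoundedState (o : EdgeOrientation G) (v : EuclideanSpace ℝ (Fin p)) (B : ℝ)
    (X : State N p n) : Prop where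
  relPos_le : ‖relPos o X.1‖ ≤ B
  agent_le : ‖X.2.1‖ ≤ B
  error_le : ‖X.2.2 - fun _ => v‖ ≤ B

theorem exists_norm_le_of_mem_quantizedSelections (o : EdgeOrientation G) (hΔ : 0 < Δ) (B : ℝ) :
    ∃ C, ∀ x : Fin N → EuclideanSpace ℝ (Fin p), ‖relPos o x‖ ≤ B →
      ∀ w ∈ quantizedSelections o Δ x, ‖w‖ ≤ C := by
  rcases lt_or_ge B 0 with hB | hB
  · exact ⟨0, fun x hx => absurd ((norm_nonneg _).trans hx) (not_le.2 hB)⟩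
  refine ⟨p * (B + Δ / 2), fun x hx w hw => ?_⟩
  refine (pi_norm_le_iff_of_nonneg (by positivity)).2 fun e => ?_
  refine (EuclideanSpace.norm_le_sum_abs (w e)).trans ?_
  have : ∀ j ∈ Finset.univ, |w e j| ≤ B + Δ / 2 := by
    intro j _
    have h1 := abs_le_of_mem_quantizerBox hΔ (hw e j)
    have h2 : |relPos o x e j| ≤ B :=
      (PiLp.norm_apply_le (relPos o x e) j).trans ((norm_le_pi_norm _ e).trans hx)
    linarith
  simpa [mul_add] using Finset.sum_le_card_nsmul _ _ _ this

theorem exists_norm_agentField_le (hΔ : 0 < Δ)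
    (hf : ∀ i, Continuous (f i)) (hg : ∀ i, Continuous (g i)) (hh : ∀ i, Continuous (h i))
    (o : EdgeOrientation G) (v : EuclideanSpace ℝ (Fin p)) (B : ℝ) :
    ∃ M, 0 ≤ M ∧ ∀ X : State N p n, IsBoundedState o v B X →
      ∀ w ∈ quantizedSelections o Δ X.1,
        ‖w‖ ≤ M ∧ ‖edgeInput o w‖ ≤ M ∧ ‖agentField leader f g h Λ X (edgeInput o w)‖ ≤ M := by
  obtain ⟨C, hC⟩ := exists_norm_le_of_mem_quantizedSelections (p := p) o hΔ B
  set R := B + ‖v‖ with hR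
  have hK := ((isCompact_closedBall (0 : State N p n) R).prod
    (isCompact_closedBall (0 : G.edgeSet → EuclideanSpace ℝ (Fin p)) C))
  have hc : Continuous fun q : State N p n × (G.edgeSet → EuclideanSpace ℝ (Fin p)) =>
      agentField leader f g h Λ q.1 (edgeInput o q.2) :=
    (continuous_agentField hf hg hh).comp
      (continuous_fst.prodMk ((continuous_edgeInput o).comp continuous_snd))
  obtain ⟨M₁, hM₁⟩ := hK.exists_bound_of_continuousOn hc.continuousOn
  obtain ⟨M₂, hM₂⟩ := hK.exists_bound_of_continuousOn
    (f := fun q : State N p n × (G.edgeSet → EuclideanSpace ℝ (Fin p)) => edgeInput o q.2)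
    ((continuous_edgeInput o).comp continuous_snd).continuousOn
  refine ⟨max 0 (max C (max M₁ M₂)), le_max_left _ _, fun X hX w hw => ?_⟩
  have hw' := hC X.1 hX.relPos_le w hw
  have hB : 0 ≤ B := (norm_nonneg _).trans hX.relPos_le
  have hv : ‖X.2.2‖ ≤ R := by
    have h1 : ‖(fun _ => v : Fin N → EuclideanSpace ℝ (Fin p))‖ ≤ ‖v‖ :=
      (pi_norm_le_iff_of_nonneg (norm_nonneg v)).2 fun _ => le_rfl
    calc ‖X.2.2‖ = ‖(X.2.2 - fun _ => v) + fun _ => v‖ := by rw [sub_add_cancel]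
      _ ≤ _ := (norm_add_le _ _).trans (add_le_add hX.error_le h1)
  -- Once `w` is given, the field does not depend on the positions. They may be unbounded, and are
  -- replaced by `0` to reach a compact set.
  have hmem : (((0, X.2) : State N p n), w) ∈ Metric.closedBall (0 : State N p n) R ×ˢ
      Metric.closedBall (0 : G.edgeSet → EuclideanSpace ℝ (Fin p)) C := by
    refine ⟨?_, mem_closedBall_zero_iff.2 hw'⟩
    rw [mem_closedBall_zero_iff]
    refine max_le (by simpa using by positivity) (max_le ?_ hv)
    exact hX.agent_le.trans (le_add_of_nonneg_right (norm_nonneg v))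
  refine ⟨hw'.trans (by simp), (hM₂ _ hmem).trans (by simp), (hM₁ _ hmem).trans (by simp)⟩

theorem closedLoop_locally_bounded (hΔ : 0 < Δ)
    (hf : ∀ i, Continuous (f i)) (hg : ∀ i, Continuous (g i)) (hh : ∀ i, Continuous (h i))
    (o : EdgeOrientation G) (x : State N p n) :
    ∃ R > 0, ∃ M, ∀ y ∈ Metric.ball x R, ‖closedLoop o leader Δ f g h Λ y‖ ≤ M := by
  obtain ⟨B, hB⟩ := (isCompact_closedBall x 1).exists_bound_of_continuousOn
    (f := fun X : State N p n =>
      (relPos o X.1, X.2.1, X.2.2 - fun _ => (0 : EuclideanSpace ℝ (Fin p))))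
    (by
      have := continuous_relPos (p := p) o
      fun_prop)
  obtain ⟨M, -, hM⟩ := exists_norm_agentField_le (leader := leader) (Λ := Λ) hΔ hf hg hh o 0 B
  refine ⟨1, one_pos, M, fun y hy => ?_⟩
  have h1 := hB y (Metric.ball_subset_closedBall hy)
  rw [norm_prod_le_iff, norm_prod_le_iff] at h1
  refine (hM y ⟨h1.1, h1.2.1, h1.2.2⟩
    (fun e => quantizerVec Δ (relPos o y.1 e)) fun e j => ?_).2.2
  exact quantizer_mem_quantizerBox hΔ _

namespace LyapunovData

variable (D : LyapunovData leader f g h Λ)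

/-- The Lyapunov function of the closed loop. -/
noncomputable def energy (o : EdgeOrientation G) (Δ : ℝ) (v : EuclideanSpace ℝ (Fin p))
    (X : State N p n) : ℝ := couplingEnergy o Δ X.1 + D.storage v X

theorem energy_nonneg (hΔ : 0 < Δ) (X : State N p n) : 0 ≤ D.energy o Δ v X :=
  add_nonneg (couplingEnergy_nonneg o hΔ _) (D.storage_nonneg v X)

/-- Each energy term is coercive in its own variable: `Q` has linear growth, `S i` is radially
unbounded and `A i` is coercive. The positions enter only through `relPos`, so they are not bounded.
-/
theorem exists_isBoundedState_of_energy_le (hΔ : 0 < Δ) (o : EdgeOrientation G)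
    (v : EuclideanSpace ℝ (Fin p)) (C : ℝ) :
    ∃ B, ∀ X : State N p n, D.energy o Δ v X ≤ C → IsBoundedState o v B X := by
  have hξ : ∀ i, ∃ R, ∀ ξ, D.S i ξ ≤ C → ‖ξ‖ ≤ R := by
    intro i
    have h1 := (D.tendsto_S i).eventually_gt_atTop C
    obtain ⟨K, hK, hKS⟩ := mem_cocompact.1 h1
    obtain ⟨R, hR⟩ := hK.isBounded.exists_norm_le
    refine ⟨R, fun ξ hξ => hR ξ ?_⟩
    by_contra hn
    exact absurd (hKS hn) (not_lt.2 hξ)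
  choose R hR using hξ
  have hv : ∀ i, ∃ Q, 0 ≤ Q ∧ ∀ x : EuclideanSpace ℝ (Fin p),
      D.c i / 2 * ‖x‖ ^ 2 ≤ C → ‖x‖ ≤ Q := by
    intro i
    have hc := D.c_pos i
    refine ⟨√(2 * C / D.c i), Real.sqrt_nonneg _, fun x hx => Real.le_sqrt_of_sq_le ?_⟩
    rw [le_div_iff₀ hc]
    linarith
  choose Q hQ0 hQ using hv
  set B := (p * |C / Δ + Δ / 2|) + (∑ i, |R i|) + ∑ i, Q i with hB
  have b1 : 0 ≤ p * |C / Δ + Δ / 2| := by positivity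
  have b2 : 0 ≤ ∑ i, |R i| := Finset.sum_nonneg fun _ _ => abs_nonneg _
  have b3 : 0 ≤ ∑ i, Q i := Finset.sum_nonneg fun i _ => hQ0 i
  have hB0 : 0 ≤ B := by positivity
  refine ⟨B, fun X hX => ?_⟩
  have hce : couplingEnergy o Δ X.1 ≤ C := by
    have := D.storage_nonneg v X
    rw [energy] at hX
    linarith
  have hst : D.storage v X ≤ C := by
    have := couplingEnergy_nonneg o hΔ X.1
    rw [energy] at hX
    linarith
  refine ⟨(pi_norm_le_iff_of_nonneg hB0).2 fun e => ?_,
    (pi_norm_le_iff_of_nonneg hB0).2 fun i => ?_,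
    (pi_norm_le_iff_of_nonneg hB0).2 fun i => ?_⟩
  · refine (EuclideanSpace.norm_le_sum_abs _).trans (le_trans ?_
      (show p * |C / Δ + Δ / 2| ≤ B by linarith))
    have : ∀ j ∈ Finset.univ, |relPos o X.1 e j| ≤ |C / Δ + Δ / 2| := by
      intro j _
      have h1 := (mul_abs_sub_le_quantizerPotential hΔ (relPos o X.1 e j)).trans
        ((quantizerPotential_le_couplingEnergy o hΔ X.1 e j).trans hce)
      refine le_trans ?_ (le_abs_self _)
      have h2 := (le_div_iff₀' hΔ).2 h1
      linarith
    simpa using Finset.sum_le_card_nsmul _ _ _ this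
  · have h1 := hR i _ ((D.S_le_storage v X i).trans hst)
    have h2 := Finset.single_le_sum (f := fun i => |R i|) (fun _ _ => abs_nonneg _)
      (Finset.mem_univ i)
    have h3 := le_abs_self (R i)
    linarith
  · have h1 := hQ i _ ((D.norm_sq_le_storage v X i).trans hst)
    have h2 := Finset.single_le_sum (f := Q) (fun i _ => hQ0 i) (Finset.mem_univ i)
    simp only [Pi.sub_apply]
    linarith

end LyapunovData

namespace IsSelectionSolution

variable (hX : IsSelectionSolution o leader Δ f g h Λ v X I)
include hX

theorem Icc_subset {s t : ℝ} (hs : s ∈ I) (ht : t ∈ I) : Icc s t ⊆ I := hX.ordConnected.out hs ht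

theorem leader_eq {t : ℝ} (ht : t ∈ I) : (X t).2.2 leader = v := by
  have hsub := hX.Icc_subset hX.zero_mem ht
  have h0t := hX.subset_Ici ht
  have hlip : LipschitzOnWith 1 (fun X : State N p n => X.2.2 leader) univ :=
    ((LipschitzWith.eval leader).comp
      (LipschitzWith.prod_snd.comp LipschitzWith.prod_snd)).lipschitzOnWith.weaken (by simp)
  have hac := hlip.comp_absolutelyContinuousOnInterval (hX.ac 0 t h0t hsub) (mapsTo_univ _ _)
  have := norm_sub_le_of_ae_hasDerivAt (M := 0) h0t hac (by
    filter_upwards [hX.ae_hasDerivAt] with s hs hst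
    obtain ⟨w, -, hd⟩ := hs (hsub hst)
    refine ⟨0, ?_, by simp⟩
    have h1 := (hasDerivAt_pi.1 ((ContinuousLinearMap.snd ℝ _ _).hasFDerivAt.comp_hasDerivAt s
      ((ContinuousLinearMap.snd ℝ _ _).hasFDerivAt.comp_hasDerivAt s hd))) leader
    simpa [agentField] using h1)
  rw [hX.leader_zero, zero_mul, norm_le_zero_iff, sub_eq_zero] at this
  exact this

/-- On the compact image of the interval a locally Lipschitz function is Lipschitz; the nonsmooth
energy can thus be integrated along `X`. -/
theorem absolutelyContinuousOnInterval_comp {φ : State N p n → ℝ} (hφ : LocallyLipschitz φ)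
    {s t : ℝ} (hst : s ≤ t) (hsub : Icc s t ⊆ I) :
    AbsolutelyContinuousOnInterval (fun r => φ (X r)) s t := by
  have hac := hX.ac s t hst hsub
  obtain ⟨K, hK⟩ := (hφ.locallyLipschitzOn (s := X '' uIcc s t)).exists_lipschitzOnWith_of_compact
    (isCompact_uIcc.image_of_continuousOn hac.continuousOn)
  exact hK.comp_absolutelyContinuousOnInterval hac (mapsTo_image _ _)

theorem energy_sub_le (D : LyapunovData leader f g h Λ) (hΔ : 0 < Δ) {s t c : ℝ} (hst : s ≤ t)
    (hsub : Icc s t ⊆ I) (hc : ∀ r ∈ Icc s t, c ≤ D.dissipation (X r)) :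
    D.energy o Δ v (X t) - D.energy o Δ v (X s) ≤ -c * (t - s) := by
  refine sub_le_of_ae_hasDerivAt_le (φ := fun r => D.energy o Δ v (X r)) hst
    (hX.absolutelyContinuousOnInterval_comp (D.locallyLipschitz_energy o v hΔ) hst hsub) ?_
  have hdiff : ∀ᵐ r : ℝ, ∀ e j, r ∈ uIcc s t →
      DifferentiableAt ℝ (fun r => quantizerPotential Δ (relPos o (X r).1 e j)) r :=
    ae_all_iff.2 fun e => ae_all_iff.2 fun j =>
      (hX.absolutelyContinuousOnInterval_comp
        (LyapunovData.locallyLipschitz_quantizerPotential_relPos o hΔ e j)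
        hst hsub).ae_differentiableAt
  filter_upwards [hX.ae_hasDerivAt, hdiff] with r hr hrd hrm
  obtain ⟨w, hw, hd⟩ := hr (hsub hrm)
  obtain ⟨d, hd', hle⟩ := D.exists_hasDerivAt_energy_le o v hΔ hw hd (hX.leader_eq (hsub hrm))
    fun e j => hrd e j (by rwa [uIcc_of_le hst])
  exact ⟨d, hd', hle.trans (neg_le_neg (hc r hrm))⟩

theorem energy_anti (D : LyapunovData leader f g h Λ) (hΔ : 0 < Δ) {s t : ℝ} (hst : s ≤ t)
    (hs : s ∈ I) (ht : t ∈ I) : D.energy o Δ v (X t) ≤ D.energy o Δ v (X s) := by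
  have := hX.energy_sub_le D hΔ hst (hX.Icc_subset hs ht) (c := 0)
    fun r _ => D.dissipation_nonneg _
  linarith

theorem exists_isBoundedState (D : LyapunovData leader f g h Λ) (hΔ : 0 < Δ) :
    ∃ B, ∀ t ∈ I, IsBoundedState o v B (X t) := by
  obtain ⟨B, hB⟩ := D.exists_isBoundedState_of_energy_le hΔ o v (D.energy o Δ v (X 0))
  exact ⟨B, fun t ht => hB _ (hX.energy_anti D hΔ (hX.subset_Ici ht) hX.zero_mem ht)⟩

theorem exists_lipschitzOnWith (D : LyapunovData leader f g h Λ) (hΔ : 0 < Δ)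
    (hf : ∀ i, Continuous (f i)) (hg : ∀ i, Continuous (g i)) (hh : ∀ i, Continuous (h i)) :
    ∃ K, LipschitzOnWith K X I := by
  obtain ⟨B, hB⟩ := hX.exists_isBoundedState D hΔ
  obtain ⟨M, hM0, hM⟩ := exists_norm_agentField_le (leader := leader) (Λ := Λ) hΔ hf hg hh o v B
  refine ⟨M.toNNReal, LipschitzOnWith.of_dist_le_mul fun s hs t ht => ?_⟩
  rw [Real.coe_toNNReal M hM0]
  wlog hst : t ≤ s generalizing s t
  · rw [dist_comm, dist_comm s]
    exact this t ht s hs (le_of_not_ge hst)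
  rw [Real.dist_eq, abs_of_nonneg (sub_nonneg.2 hst), dist_eq_norm]
  have hsub := hX.Icc_subset ht hs
  refine norm_sub_le_of_ae_hasDerivAt hst (hX.ac t s hst hsub) ?_
  filter_upwards [hX.ae_hasDerivAt] with r hr hrm
  obtain ⟨w, hw, hd⟩ := hr (hsub hrm)
  exact ⟨_, hd, (hM _ (hB r (hsub hrm)) w hw).2.2⟩

end IsSelectionSolution

end Solutions

/-! ### Convergence of the agents' states and of the velocity estimates -/

section Asymptotics

variable {N p : ℕ} {n : Fin N → ℕ} {leader : Fin N}
  {f : (i : Fin N) → EuclideanSpace ℝ (Fin (n i)) → EuclideanSpace ℝ (Fin (n i))}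
  {g : (i : Fin N) → EuclideanSpace ℝ (Fin (n i)) →
    (EuclideanSpace ℝ (Fin p) →L[ℝ] EuclideanSpace ℝ (Fin (n i)))}
  {h : (i : Fin N) → EuclideanSpace ℝ (Fin (n i)) → EuclideanSpace ℝ (Fin p)}
  {Λ : Fin N → Matrix (Fin p) (Fin p) ℝ}
  {G : SimpleGraph (Fin N)} [Fintype G.edgeSet] {o : EdgeOrientation G} {Δ : ℝ}
  {v : EuclideanSpace ℝ (Fin p)} {X : ℝ → State N p n} {I : Set ℝ}

omit [Fintype G.edgeSet] in
variable (n) in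
/-- The relative positions as continuous linear functions of the state. -/
theorem exists_relPosProj (o : EdgeOrientation G) (e : G.edgeSet) :
    ∃ L : State N p n →L[ℝ] EuclideanSpace ℝ (Fin p), ∀ Y, L Y = relPos o Y.1 e :=
  ⟨(ContinuousLinearMap.proj (R := ℝ) (φ := fun _ : Fin N => EuclideanSpace ℝ (Fin p)) (o.pos e) -
    ContinuousLinearMap.proj (R := ℝ) (φ := fun _ : Fin N => EuclideanSpace ℝ (Fin p))
      (o.neg e)).comp
    (ContinuousLinearMap.fst ℝ _ _), fun Y => (relPos_apply o Y.1 e).symm⟩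

namespace IsSelectionSolution

/-- The common tool of the window estimates: if a linear observable has velocity near `c` for every
admissible selection, it moves almost like `t • c`. -/
theorem norm_map_sub_sub_smul_le (hX : IsSelectionSolution o leader Δ f g h Λ v X I)
    {F : Type*} [NormedAddCommGroup F] [NormedSpace ℝ F] (L : State N p n →L[ℝ] F) (c : F)
    {s t M : ℝ} (hs : s ∈ I) (ht : t ∈ I) (hst : s ≤ t)
    (hM : ∀ r ∈ Icc s t, ∀ w ∈ quantizedSelections o Δ (X r).1,
      ‖L (agentField leader f g h Λ (X r) (edgeInput o w)) - c‖ ≤ M) :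
    ‖L (X t) - L (X s) - (t - s) • c‖ ≤ M * (t - s) := by
  have hsub := hX.Icc_subset hs ht
  have hlin : LipschitzWith ‖c‖₊ fun r : ℝ => r • c := by
    refine LipschitzWith.of_dist_le_mul fun a b => ?_
    rw [dist_eq_norm, ← sub_smul, norm_smul, mul_comm, coe_nnnorm, Real.dist_eq, Real.norm_eq_abs]
  have hac : AbsolutelyContinuousOnInterval (fun r => L (X r) - r • c) s t :=
    ((L.lipschitz.lipschitzOnWith (s := univ)).comp_absolutelyContinuousOnInterval
      (hX.ac s t hst hsub) (mapsTo_univ _ _)).sub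
      hlin.lipschitzOnWith.absolutelyContinuousOnInterval
  have := norm_sub_le_of_ae_hasDerivAt (M := M) hst hac (by
    filter_upwards [hX.ae_hasDerivAt] with r hr hrm
    obtain ⟨w, hw, hd⟩ := hr (hsub hrm)
    refine ⟨_, (L.hasFDerivAt.comp_hasDerivAt r hd).sub ((hasDerivAt_id r).smul_const c), ?_⟩
    simpa using hM r hrm w hw)
  convert this using 2
  rw [sub_smul]
  abel

theorem map_sub_le (hX : IsSelectionSolution o leader Δ f g h Λ v X I)
    (L : State N p n →L[ℝ] ℝ) {s t c : ℝ} (hs : s ∈ I) (ht : t ∈ I) (hst : s ≤ t)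
    (hc : ∀ r ∈ Icc s t, ∀ w ∈ quantizedSelections o Δ (X r).1,
      L (agentField leader f g h Λ (X r) (edgeInput o w)) ≤ c) :
    L (X t) - L (X s) ≤ c * (t - s) := by
  have hsub := hX.Icc_subset hs ht
  refine sub_le_of_ae_hasDerivAt_le (φ := fun r => L (X r)) hst
    ((L.lipschitz.lipschitzOnWith (s := univ)).comp_absolutelyContinuousOnInterval
      (hX.ac s t hst hsub) (mapsTo_univ _ _)) ?_
  filter_upwards [hX.ae_hasDerivAt] with r hr hrm
  obtain ⟨w, hw, hd⟩ := hr (hsub hrm)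
  exact ⟨_, L.hasFDerivAt.comp_hasDerivAt r hd, hc r hrm w hw⟩

theorem continuousOn (hX : IsSelectionSolution o leader Δ f g h Λ v X (Ici 0)) :
    ContinuousOn X (Ici 0) := by
  intro t ht
  have ht' : (0 : ℝ) ≤ t := ht
  have h1 := (hX.ac 0 (t + 1) (by linarith) Icc_subset_Ici_self).continuousOn
  rw [uIcc_of_le (by linarith)] at h1
  refine (h1 t ⟨ht, by linarith⟩).mono_of_mem_nhdsWithin ?_
  filter_upwards [self_mem_nhdsWithin, nhdsWithin_le_nhds (Iic_mem_nhds (lt_add_one t))]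
    with s h1 h2
  exact ⟨h1, h2⟩

/-- The position component of the field contains no quantizer and is continuous along `X`, so the
derivative exists at every positive time and not just almost everywhere. -/
theorem hasDerivAt_fst (hX : IsSelectionSolution o leader Δ f g h Λ v X (Ici 0))
    (hh : ∀ i, Continuous (h i)) {t : ℝ} (ht : 0 < t) :
    HasDerivAt (fun s => (X s).1) (fun i => h i ((X t).2.1 i) + (X t).2.2 i) t := by
  set φ : State N p n → Fin N → EuclideanSpace ℝ (Fin p) :=
    fun X i => h i (X.2.1 i) + X.2.2 i with hφ
  have hφc : Continuous φ := continuous_pi fun i => by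
    have := hh i
    fun_prop
  have hXt : ContinuousAt (fun s => φ (X s)) t :=
    hφc.continuousAt.comp (hX.continuousOn.continuousAt (Ici_mem_nhds ht))
  rw [hasDerivAt_iff_isLittleO, Asymptotics.isLittleO_iff]
  intro ε hε
  obtain ⟨δ, hδ, hball⟩ := Metric.continuousAt_iff.1 hXt ε hε
  have key : ∀ a b, 0 < a → a ≤ b → (∀ r ∈ Icc a b, dist r t < δ) →
      ‖(X b).1 - (X a).1 - (b - a) • φ (X t)‖ ≤ ε * (b - a) := by
    intro a b ha hab hr
    refine hX.norm_map_sub_sub_smul_le (ContinuousLinearMap.fst ℝ _ _) _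
      (mem_Ici.2 ha.le) (mem_Ici.2 (ha.le.trans hab)) hab fun r hrm w _ => ?_
    rw [← dist_eq_norm]
    exact (hball (hr r hrm)).le
  filter_upwards [Ioi_mem_nhds ht, Metric.ball_mem_nhds t hδ] with s hs hsδ
  have hsδ' : |s - t| < δ := hsδ
  rcases le_total t s with hts | hts
  · rw [Real.norm_of_nonneg (sub_nonneg.2 hts)]
    refine key t s ht hts fun r hr => ?_
    rw [abs_lt] at hsδ'
    rw [Real.dist_eq, abs_lt]
    constructor <;> linarith [hr.1, hr.2]
  · rw [Real.norm_of_nonpos (sub_nonpos.2 hts), neg_sub]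
    have := key s t hs hts fun r hr => by
      rw [abs_lt] at hsδ'
      rw [Real.dist_eq, abs_lt]
      constructor <;> linarith [hr.1, hr.2]
    have e : (X s).1 - (X t).1 - (s - t) • φ (X t)
        = -((X t).1 - (X s).1 - (t - s) • φ (X t)) := by
      rw [sub_smul, sub_smul]
      abel
    rw [e, norm_neg]
    exact this

section Limits

variable (hX : IsSelectionSolution o leader Δ f g h Λ v X (Ici 0))
include hX

/-- The energy is nonincreasing and bounded below, so its later losses become arbitrarily small. -/
theorem exists_energy_sub_lt (D : LyapunovData leader f g h Λ) (hΔ : 0 < Δ) {η : ℝ}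
    (hη : 0 < η) : ∃ T, 0 ≤ T ∧ ∀ t, T ≤ t → ∀ s, t ≤ s →
      D.energy o Δ v (X t) - D.energy o Δ v (X s) < η := by
  set A := (fun t => D.energy o Δ v (X t)) '' Ici 0
  have hbdd : BddBelow A := ⟨0, by rintro _ ⟨t, -, rfl⟩; exact D.energy_nonneg hΔ _⟩
  obtain ⟨_, ⟨T, hT, rfl⟩, hlt⟩ :=
    Real.lt_sInf_add_pos (s := A) ⟨_, mem_image_of_mem _ self_mem_Ici⟩ hη
  have hT' : (0 : ℝ) ≤ T := hT
  refine ⟨T, hT, fun t ht s hs => ?_⟩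
  have h1 := hX.energy_anti D hΔ ht hT (mem_Ici.2 (hT'.trans ht))
  have h2 : sInf A ≤ D.energy o Δ v (X s) :=
    csInf_le hbdd (mem_image_of_mem _ (mem_Ici.2 (hT'.trans (ht.trans hs))))
  simp only at hlt
  linarith

theorem tendsto_agents (D : LyapunovData leader f g h Λ) (hΔ : 0 < Δ)
    (hf : ∀ i, Continuous (f i)) (hg : ∀ i, Continuous (g i)) (hh : ∀ i, Continuous (h i)) :
    Tendsto (fun t => (X t).2.1) atTop (𝓝 0) := by
  obtain ⟨B, hB⟩ := hX.exists_isBoundedState D hΔ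
  obtain ⟨K, hK⟩ := hX.exists_lipschitzOnWith D hΔ hf hg hh
  rw [Metric.tendsto_nhds]
  intro ε hε
  set φ : ((i : Fin N) → EuclideanSpace ℝ (Fin (n i))) → ℝ := fun ξ => ∑ i, D.W i (ξ i) with hφ
  have hφc : Continuous φ := by
    have := D.continuous_W
    fun_prop
  have hcomp : IsCompact (Metric.closedBall 0 B ∩
      {ξ : (i : Fin N) → EuclideanSpace ℝ (Fin (n i)) | ε / 2 ≤ ‖ξ‖}) :=
    (isCompact_closedBall _ _).inter_right (isClosed_le continuous_const continuous_norm)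
  obtain ⟨c, hc0, hc⟩ := hcomp.exists_forall_le' (f := φ) hφc.continuousOn (a := 0) (by
    rintro ξ ⟨-, hξ⟩
    have hξ' : ξ ≠ 0 := by
      rintro rfl
      simp only [mem_ofPred_eq, norm_zero] at hξ
      linarith
    obtain ⟨i, hi⟩ := Function.ne_iff.1 hξ'
    exact Finset.sum_pos' (fun i _ => D.W_nonneg i _) ⟨i, Finset.mem_univ i, D.W_pos i _ hi⟩)
  -- Within time `δ` the `K`-Lipschitz solution moves by at most `ε / 2`. If `‖ξ‖ ≥ ε` at time `t`,
  -- then `‖ξ‖ ≥ ε / 2` on `[t, t + δ]`, costing at least `c * δ` of energy.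
  set δ := ε / 2 / (K + 1) with hδ
  have hδ0 : 0 < δ := by positivity
  obtain ⟨T, hT0, hT⟩ := hX.exists_energy_sub_lt D hΔ (mul_pos hc0 hδ0)
  filter_upwards [eventually_ge_atTop T] with t ht
  rw [dist_zero_right]
  by_contra! hge
  have ht0 : 0 ≤ t := hT0.trans ht
  have := hX.energy_sub_le D hΔ (c := c) (le_add_of_nonneg_right hδ0.le : t ≤ t + δ)
    (fun r hr => mem_Ici.2 (ht0.trans hr.1)) fun r hr => by
      have hr0 : 0 ≤ r := ht0.trans hr.1
      refine hc (X r).2.1 ⟨mem_closedBall_zero_iff.2 (hB r hr0).agent_le, ?_⟩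
      have h1 : dist (X t) (X r) ≤ K * δ := by
        refine (hK.dist_le_mul t (mem_Ici.2 ht0) r (mem_Ici.2 hr0)).trans ?_
        gcongr
        rw [Real.dist_eq, abs_sub_comm, abs_of_nonneg (sub_nonneg.2 hr.1)]
        linarith [hr.2]
      have h2 : K * δ ≤ ε / 2 := by
        rw [hδ, mul_div_assoc', div_le_iff₀ (by positivity)]
        nlinarith [K.coe_nonneg]
      have h3 : ‖(X t).2.1 - (X r).2.1‖ ≤ dist (X t) (X r) := by
        rw [dist_eq_norm]
        exact (norm_fst_le (X t - X r).2).trans (norm_snd_le _)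
      have h4 := norm_sub_norm_le (X t).2.1 (X r).2.1
      simp only [mem_ofPred_eq]
      linarith
  have h2 := hT t ht (t + δ) (by linarith)
  linarith

/-- The velocity estimates are asymptotically constant on bounded time windows. -/
theorem eventually_norm_velocity_sub_le (D : LyapunovData leader f g h Λ) (hΔ : 0 < Δ)
    (hf : ∀ i, Continuous (f i)) (hg : ∀ i, Continuous (g i)) (hh : ∀ i, Continuous (h i))
    (hf0 : ∀ i, f i 0 = 0) (hg0 : ∀ i, Function.Injective (g i 0)) {T ε : ℝ} (hT : 0 ≤ T)
    (hε : 0 < ε) :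
    ∀ᶠ t in atTop, ∀ s ∈ Icc t (t + T), ‖(X s).2.2 - (X t).2.2‖ ≤ ε := by
  obtain ⟨B, hB⟩ := hX.exists_isBoundedState D hΔ
  obtain ⟨M, hM0, hM⟩ := exists_norm_agentField_le (leader := leader) (Λ := Λ) hΔ hf hg hh o v B
  have hξ := hX.tendsto_agents D hΔ hf hg hh
  have hcoord : ∀ i, ∀ᶠ t in atTop, ∀ s ∈ Icc t (t + T), ‖(X s).2.2 i - (X t).2.2 i‖ ≤ ε := by
    intro i
    by_cases hi : i = leader
    · filter_upwards [eventually_ge_atTop 0] with t ht s hs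
      rw [hi, hX.leader_eq (mem_Ici.2 ht), hX.leader_eq (mem_Ici.2 (ht.trans hs.1))]
      simpa using hε.le
    obtain ⟨κ, -, hκ⟩ := (g i 0).toLinearMap.exists_antilipschitzWith
      (LinearMap.ker_eq_bot.2 (hg0 i))
    have hci := D.c_pos i
    -- The drift of `ξ - g(0) A v̂` over the window contributes `(1 + M) * T`, the two end values of
    -- `ξ` contribute `2`; `κ` and `D.c i` undo `g i 0` and `D.A i`.
    obtain ⟨η, hη, hηε⟩ : ∃ η : ℝ, 0 < η ∧ κ * (η * ((1 + M) * T + 2)) ≤ D.c i * ε := by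
      refine ⟨D.c i * ε / (κ * ((1 + M) * T + 2) + 1), by positivity, ?_⟩
      rw [← mul_assoc, mul_comm (κ : ℝ), mul_assoc, div_mul_eq_mul_div, div_le_iff₀ (by positivity)]
      have : 0 ≤ D.c i * ε := by positivity
      nlinarith
    have hξi : Tendsto (fun t => (X t).2.1 i) atTop (𝓝 0) := (tendsto_pi_nhds.1 hξ) i
    have e1 : ∀ᶠ t in atTop, ‖(X t).2.1 i‖ < η := by
      have := hξi.norm
      rw [norm_zero] at this
      exact this.eventually_lt_const hη
    have e2 : ∀ᶠ t in atTop, ‖f i ((X t).2.1 i)‖ < η := by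
      have := (((hf i).tendsto 0).comp hξi).norm
      rw [hf0, norm_zero] at this
      exact this.eventually_lt_const hη
    have e3 : ∀ᶠ t in atTop, ‖g i ((X t).2.1 i) - g i 0‖ < η := by
      have := ((((hg i).tendsto 0).comp hξi).sub_const (g i 0)).norm
      rw [sub_self, norm_zero] at this
      exact this.eventually_lt_const hη
    obtain ⟨t₀, ht₀⟩ := eventually_atTop.1 (e1.and (e2.and (e3.and (eventually_ge_atTop 0))))
    filter_upwards [eventually_ge_atTop t₀] with t ht s hs
    have ht0 : 0 ≤ t := (ht₀ t ht).2.2.2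
    -- In this combination the input enters only through `g(ξ) - g(0)`, which is small whatever
    -- selection is taken.
    obtain ⟨L, hL⟩ : ∃ L : State N p n →L[ℝ] EuclideanSpace ℝ (Fin (n i)),
        ∀ Y, L Y = Y.2.1 i - g i 0 (D.A i (Y.2.2 i)) :=
      ⟨(ContinuousLinearMap.proj (φ := fun i => EuclideanSpace ℝ (Fin (n i))) i).comp
        ((ContinuousLinearMap.fst ℝ _ _).comp (ContinuousLinearMap.snd ℝ _ _)) -
        (g i 0).comp ((D.A i).comp ((ContinuousLinearMap.proj i).comp
        ((ContinuousLinearMap.snd ℝ _ _).comp (ContinuousLinearMap.snd ℝ _ _)))), fun _ => rfl⟩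
    have h1 := hX.norm_map_sub_sub_smul_le L 0 (M := η + η * M)
      (mem_Ici.2 ht0) (mem_Ici.2 (ht0.trans hs.1)) hs.1 fun r hr w hw => by
        obtain ⟨-, hr2, hr3, hr0⟩ := ht₀ r (ht.trans hr.1)
        have hu := (hM _ (hB r hr0) w hw).2.1
        have e : L (agentField leader f g h Λ (X r) (edgeInput o w)) - 0
            = f i ((X r).2.1 i) + (g i ((X r).2.1 i) - g i 0) (edgeInput o w i) := by
          simp only [hL, agentField, hi, if_false, D.A_toEuclideanLin i hi, sub_apply]
          abel
        rw [e]
        refine (norm_add_le _ _).trans (add_le_add hr2.le ?_)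
        refine (ContinuousLinearMap.le_opNorm _ _).trans ?_
        gcongr
        exact (norm_le_pi_norm _ i).trans hu
    have h2 : ‖g i 0 (D.A i ((X s).2.2 i - (X t).2.2 i))‖ ≤ η * ((1 + M) * T + 2) := by
      have e : g i 0 (D.A i ((X s).2.2 i - (X t).2.2 i)) = (X s).2.1 i - (X t).2.1 i -
          (L (X s) -
          L (X t) -
          (s - t) • 0) := by
        simp only [hL, map_sub, smul_zero]
        abel
      rw [e]
      have h3 := (ht₀ s (ht.trans hs.1)).1
      have h4 := (ht₀ t ht).1
      have h5 : (η + η * M) * (s - t) ≤ (η + η * M) * T := by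
        gcongr
        linarith [hs.2]
      refine (norm_sub_le _ _).trans ?_
      have := norm_sub_le ((X s).2.1 i) ((X t).2.1 i)
      linarith
    set x := (X s).2.2 i - (X t).2.2 i with hx
    have h3 : ‖D.A i x‖ ≤ κ * ‖g i 0 (D.A i x)‖ := by
      have := hκ.le_mul_dist (D.A i x) 0
      simpa using this
    have h4 : D.c i * ‖x‖ ^ 2 ≤ ‖D.A i x‖ * ‖x‖ :=
      (D.A_coercive i x).trans (real_inner_le_norm _ _)
    have h5 : ‖D.A i x‖ ≤ D.c i * ε :=
      h3.trans ((mul_le_mul_of_nonneg_left h2 κ.coe_nonneg).trans hηε)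
    by_contra! hlt
    have hxpos : 0 < ‖x‖ := hε.trans hlt
    have h6 : D.c i * ‖x‖ ≤ ‖D.A i x‖ := by
      refine le_of_mul_le_mul_right ?_ hxpos
      linarith
    have h7 : D.c i * ε < D.c i * ‖x‖ := by gcongr
    linarith
  filter_upwards [eventually_all.2 hcoord] with t ht s hs
  exact (pi_norm_le_iff_of_nonneg hε.le).2 fun i => ht i s hs

theorem eventually_norm_output_le (D : LyapunovData leader f g h Λ) (hΔ : 0 < Δ)
    (hf : ∀ i, Continuous (f i)) (hg : ∀ i, Continuous (g i)) (hh : ∀ i, Continuous (h i))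
    (hh0 : ∀ i, h i 0 = 0) {ε : ℝ} (hε : 0 < ε) :
    ∀ᶠ t in atTop, ∀ i, ‖h i ((X t).2.1 i)‖ ≤ ε := by
  refine eventually_all.2 fun i => ?_
  have hξi : Tendsto (fun t => (X t).2.1 i) atTop (𝓝 0) :=
    (tendsto_pi_nhds.1 (hX.tendsto_agents D hΔ hf hg hh)) i
  have := (((hh i).tendsto 0).comp hξi).norm
  rw [hh0, norm_zero] at this
  filter_upwards [this.eventually_lt_const hε] with t ht
  exact ht.le

/-- Over a window of length `1 / η` the relative position moves by `(1 / η) • Dᵀ v̂(t)` up to an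
error `4`, but by at most `2 * B` in all. So `Dᵀ v̂(t)` is of order `η`, and paths to the leader
transfer this to `v̂ - v`. -/
theorem tendsto_velocity (hG : G.Connected) (D : LyapunovData leader f g h Λ) (hΔ : 0 < Δ)
    (hf : ∀ i, Continuous (f i)) (hg : ∀ i, Continuous (g i)) (hh : ∀ i, Continuous (h i))
    (hf0 : ∀ i, f i 0 = 0) (hh0 : ∀ i, h i 0 = 0) (hg0 : ∀ i, Function.Injective (g i 0)) :
    Tendsto (fun t => (X t).2.2) atTop (𝓝 fun _ => v) := by
  obtain ⟨B, hB⟩ := hX.exists_isBoundedState D hΔ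
  have hB0 : 0 ≤ B := (norm_nonneg _).trans (hB 0 self_mem_Ici).relPos_le
  rw [Metric.tendsto_nhds]
  intro ε hε
  obtain ⟨η, hη, hηε⟩ : ∃ η : ℝ, 0 < η ∧ N * (η * (2 * B + 4)) < ε := by
    refine ⟨ε / (N * (2 * B + 4) + 1), by positivity, ?_⟩
    rw [← mul_assoc, mul_comm (N : ℝ), mul_assoc, div_mul_eq_mul_div, div_lt_iff₀ (by positivity)]
    nlinarith
  have e1 := hX.eventually_norm_velocity_sub_le D hΔ hf hg hh hf0 hg0 (T := 1 / η)
    (by positivity) hη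
  obtain ⟨t₀, ht₀⟩ := eventually_atTop.1
    ((hX.eventually_norm_output_le D hΔ hf hg hh hh0 hη).and (e1.and (eventually_ge_atTop 0)))
  filter_upwards [eventually_ge_atTop t₀] with t ht
  obtain ⟨-, ht1, ht0⟩ := ht₀ t ht
  have hηpos : 0 < 1 / η := by positivity
  have hrel : ‖relPos o (X t).2.2‖ ≤ η * (2 * B + 4) := by
    refine (pi_norm_le_iff_of_nonneg (by positivity)).2 fun e => ?_
    obtain ⟨L, hL⟩ := exists_relPosProj n o e
    -- Two outputs and two deviations of the velocity estimates, each at most `η`.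
    have h1 := hX.norm_map_sub_sub_smul_le L (relPos o (X t).2.2 e) (M := 4 * η)
      (mem_Ici.2 ht0) (mem_Ici.2 (by positivity : 0 ≤ t + 1 / η)) (by linarith) fun r hr w hw => by
        obtain ⟨hr1, -, -⟩ := ht₀ r (ht.trans hr.1)
        have h2 := ht1 r hr
        have h3 := (norm_le_pi_norm _ (o.pos e)).trans h2
        have h4 := (norm_le_pi_norm _ (o.neg e)).trans h2
        simp only [Pi.sub_apply] at h3 h4
        have heq : L (agentField leader f g h Λ (X r) (edgeInput o w)) - relPos o (X t).2.2 e
            = (h (o.pos e) ((X r).2.1 (o.pos e)) - h (o.neg e) ((X r).2.1 (o.neg e))) +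
              (((X r).2.2 (o.pos e) - (X t).2.2 (o.pos e)) -
              ((X r).2.2 (o.neg e) - (X t).2.2 (o.neg e))) := by
          simp only [hL, agentField, relPos_apply]
          abel
        rw [heq]
        have h5 := norm_sub_le (h (o.pos e) ((X r).2.1 (o.pos e)))
          (h (o.neg e) ((X r).2.1 (o.neg e)))
        have h6 := norm_sub_le ((X r).2.2 (o.pos e) - (X t).2.2 (o.pos e))
          ((X r).2.2 (o.neg e) - (X t).2.2 (o.neg e))
        refine (norm_add_le _ _).trans ?_
        linarith [hr1 (o.pos e), hr1 (o.neg e)]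
    have h2 : ∀ r, 0 ≤ r →
        ‖L (X r)‖ ≤ B := by
      intro r hr
      have := (norm_le_pi_norm _ e).trans (hB r hr).relPos_le
      rwa [hL]
    have h3 := h2 t ht0
    have h4 := h2 (t + 1 / η) (by positivity)
    rw [add_sub_cancel_left] at h1
    have h5 : ‖(1 / η) • relPos o (X t).2.2 e‖ ≤ 2 * B + 4 := by
      have h6 := norm_sub_norm_le ((1 / η) • relPos o (X t).2.2 e)
        (L (X (t + 1 / η)) -
        L (X t))
      rw [norm_sub_rev ((1 / η) • relPos o (X t).2.2 e)] at h6
      have h7 := norm_sub_le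
        (L (X (t + 1 / η)))
        (L (X t))
      have h8 : 4 * η * (1 / η) = 4 := by field
      linarith
    rw [norm_smul, Real.norm_of_nonneg hηpos.le, one_div, ← div_eq_inv_mul, div_le_iff₀ hη] at h5
    linarith
  rw [dist_eq_norm]
  refine lt_of_le_of_lt ?_ hηε
  refine (pi_norm_le_iff_of_nonneg (by positivity)).2 fun i => ?_
  rw [Pi.sub_apply, ← hX.leader_eq (mem_Ici.2 ht0)]
  refine (norm_sub_le_mul_norm_relPos hG o _ i leader).trans ?_
  gcongr

end Limits

end IsSelectionSolution

end Asymptotics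

/-! ### Convergence of the relative positions to the quantizer's dead zone -/

section Convergence

variable {N p : ℕ} {n : Fin N → ℕ} {leader : Fin N}
  {f : (i : Fin N) → EuclideanSpace ℝ (Fin (n i)) → EuclideanSpace ℝ (Fin (n i))}
  {g : (i : Fin N) → EuclideanSpace ℝ (Fin (n i)) →
    (EuclideanSpace ℝ (Fin p) →L[ℝ] EuclideanSpace ℝ (Fin (n i)))}
  {h : (i : Fin N) → EuclideanSpace ℝ (Fin (n i)) → EuclideanSpace ℝ (Fin p)}
  {Λ : Fin N → Matrix (Fin p) (Fin p) ℝ}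
  {G : SimpleGraph (Fin N)} [Fintype G.edgeSet] {o : EdgeOrientation G} {Δ : ℝ}
  {v : EuclideanSpace ℝ (Fin p)} {X : ℝ → State N p n}

/-- The work of the Krasowskii values of the quantizer at `x'` on the relative positions of a
nearby `x` controls the coupling energy of `x`. -/
theorem couplingEnergy_le_sum_inner (o : EdgeOrientation G) (hΔ : 0 < Δ) {B η : ℝ}
    {x x' : Fin N → EuclideanSpace ℝ (Fin p)} (hx : ‖relPos o x‖ ≤ B) (hx' : ‖relPos o x'‖ ≤ B)
    (hxx' : ‖relPos o x - relPos o x'‖ ≤ η) {w : G.edgeSet → EuclideanSpace ℝ (Fin p)}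
    (hw : w ∈ quantizedSelections o Δ x') :
    couplingEnergy o Δ x ≤ ∑ e, inner ℝ (w e) (relPos o x e)
      + Fintype.card G.edgeSet * (p * (2 * (B + Δ / 2) * η)) := by
  have hη : 0 ≤ η := (norm_nonneg _).trans hxx'
  have hB : 0 ≤ B := (norm_nonneg _).trans hx
  have habs : ∀ y : G.edgeSet → EuclideanSpace ℝ (Fin p), ∀ e j, |y e j| ≤ ‖y‖ := fun y e j =>
    (PiLp.norm_apply_le (y e) j).trans (norm_le_pi_norm y e)
  have key : ∀ e j, quantizerPotential Δ (relPos o x e j)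
      ≤ w e j * relPos o x e j + 2 * (B + Δ / 2) * η := by
    intro e j
    have h1 := abs_quantizerPotential_sub_le hΔ ((habs _ e j).trans hx) ((habs _ e j).trans hx')
    have h2 : |relPos o x e j - relPos o x' e j| ≤ η := (habs _ e j).trans hxx'
    -- The subgradient inequality tested at `0` gives `Q(z') ≤ w z'`; passing from `z'` to `z` costs
    -- `(B + Δ / 2) * η` on each side.
    have h3 := quantizerPotential_add_le hΔ (hw e j) 0
    rw [quantizerPotential_zero] at h3
    have h4 : |w e j| ≤ B + Δ / 2 :=
      (abs_le_of_mem_quantizerBox hΔ (hw e j)).trans (by linarith [habs (relPos o x') e j])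
    have h5 : |w e j * (relPos o x e j - relPos o x' e j)| ≤ (B + Δ / 2) * η := by
      rw [abs_mul]; gcongr
    have h6 : (B + Δ / 2) * |relPos o x e j - relPos o x' e j| ≤ (B + Δ / 2) * η := by gcongr
    have h7 := (le_abs_self _).trans h1
    have h8 := (neg_abs_le _).trans' (neg_le_neg h5)
    linarith
  calc couplingEnergy o Δ x
      ≤ ∑ e : G.edgeSet, ∑ j, (w e j * relPos o x e j + 2 * (B + Δ / 2) * η) :=
        Finset.sum_le_sum fun e _ => Finset.sum_le_sum fun j _ => key e j
    _ = _ := by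
      simp only [Finset.sum_add_distrib, Finset.sum_const, Finset.card_univ, Fintype.card_fin,
        nsmul_eq_mul, PiLp.inner_apply, RCLike.inner_apply, conj_trivial, mul_comm (w _ _)]

namespace IsSelectionSolution

variable (hX : IsSelectionSolution o leader Δ f g h Λ v X (Ici 0))
include hX

/-- The observable `∑ ⟪y_i, A_i v̂_i⟫`, with `y` frozen at time `t`, has derivative `-∑ ⟪w, z(t)⟫`,
at most minus the coupling energy plus a small error. Over a unit window it hardly changes because
`v̂` hardly changes, so the coupling energy is small. -/
theorem eventually_couplingEnergy_le (hG : G.Connected) (D : LyapunovData leader f g h Λ)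
    (hΔ : 0 < Δ)
    (hf : ∀ i, Continuous (f i)) (hg : ∀ i, Continuous (g i)) (hh : ∀ i, Continuous (h i))
    (hf0 : ∀ i, f i 0 = 0) (hh0 : ∀ i, h i 0 = 0) (hg0 : ∀ i, Function.Injective (g i 0))
    {ε : ℝ} (hε : 0 < ε) : ∀ᶠ t in atTop, couplingEnergy o Δ (X t).1 ≤ ε := by
  obtain ⟨B, hB⟩ := hX.exists_isBoundedState D hΔ
  have hB0 : 0 ≤ B := (norm_nonneg _).trans (hB 0 self_mem_Ici).relPos_le
  set C₁ : ℝ := Fintype.card G.edgeSet * (p * (2 * (B + Δ / 2) * 4)) with hC₁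
  set C₂ : ℝ := ∑ i, N * B * ‖D.A i‖ with hC₂
  have hC₁0 : 0 ≤ C₁ := by positivity
  have hC₂0 : 0 ≤ C₂ := Finset.sum_nonneg fun i _ => by positivity
  obtain ⟨η, hη, hηε⟩ : ∃ η : ℝ, 0 < η ∧ (C₁ + C₂) * η ≤ ε := by
    refine ⟨ε / (C₁ + C₂ + 1), by positivity, ?_⟩
    rw [mul_div_assoc', div_le_iff₀ (by positivity)]
    nlinarith
  have e1 := hX.eventually_norm_velocity_sub_le D hΔ hf hg hh hf0 hg0 (T := 1) zero_le_one hη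
  have e2 : ∀ᶠ t in atTop, ‖(X t).2.2 - fun _ => v‖ ≤ η := by
    filter_upwards [Metric.tendsto_nhds.1
      (hX.tendsto_velocity hG D hΔ hf hg hh hf0 hh0 hg0) η hη] with t ht
    rw [← dist_eq_norm]
    exact ht.le
  obtain ⟨t₀, ht₀⟩ := eventually_atTop.1
    ((hX.eventually_norm_output_le D hΔ hf hg hh hh0 hη).and
      (e1.and (e2.and (eventually_ge_atTop 0))))
  filter_upwards [eventually_ge_atTop t₀] with t ht
  obtain ⟨-, ht1, -, ht0⟩ := ht₀ t ht
  have ht1' : (0 : ℝ) ≤ t + 1 := by linarith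
  have hz : ∀ r ∈ Icc t (t + 1), ‖relPos o (X t).1 - relPos o (X r).1‖ ≤ 4 * η := by
    intro r hr
    refine (pi_norm_le_iff_of_nonneg (by positivity)).2 fun e => ?_
    obtain ⟨L, hL⟩ := exists_relPosProj n o e
    have h1 := hX.norm_map_sub_sub_smul_le L 0 (M := 4 * η) (mem_Ici.2 ht0)
      (mem_Ici.2 (ht0.trans hr.1)) hr.1 fun s hs w hw => by
        obtain ⟨hs1, -, hs3, -⟩ := ht₀ s (ht.trans hs.1)
        have h3 := (norm_le_pi_norm _ (o.pos e)).trans hs3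
        have h4 := (norm_le_pi_norm _ (o.neg e)).trans hs3
        simp only [Pi.sub_apply] at h3 h4
        have heq : L (agentField leader f g h Λ (X s) (edgeInput o w)) - 0
            = (h (o.pos e) ((X s).2.1 (o.pos e)) - h (o.neg e) ((X s).2.1 (o.neg e))) +
              (((X s).2.2 (o.pos e) - v) - ((X s).2.2 (o.neg e) - v)) := by
          simp only [hL, agentField, relPos_apply]
          abel
        rw [heq]
        have h5 := norm_sub_le (h (o.pos e) ((X s).2.1 (o.pos e)))
          (h (o.neg e) ((X s).2.1 (o.neg e)))
        have h6 := norm_sub_le ((X s).2.2 (o.pos e) - v) ((X s).2.2 (o.neg e) - v)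
        refine (norm_add_le _ _).trans ?_
        linarith [hs1 (o.pos e), hs1 (o.neg e)]
    rw [smul_zero, sub_zero, hL, hL] at h1
    rw [Pi.sub_apply, norm_sub_rev]
    refine h1.trans (mul_le_of_le_one_right (by positivity) ?_)
    linarith [hr.2]
  -- Positions relative to the leader: these are bounded, unlike `x`, and vanish at the leader,
  -- which has no adaptation law.
  set y : Fin N → EuclideanSpace ℝ (Fin p) := fun i => (X t).1 i - (X t).1 leader with hy
  have hyB : ∀ i, ‖y i‖ ≤ N * B := fun i =>
    (norm_sub_le_mul_norm_relPos hG o _ i leader).trans (by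
      gcongr
      exact (hB t (mem_Ici.2 ht0)).relPos_le)
  obtain ⟨L, hL⟩ : ∃ L : State N p n →L[ℝ] ℝ,
      ∀ Y, L Y = ∑ i, inner ℝ (y i) (D.A i (Y.2.2 i)) :=
    ⟨∑ i, (innerSL ℝ (y i)).comp ((D.A i).comp ((ContinuousLinearMap.proj i).comp
      ((ContinuousLinearMap.snd ℝ _ _).comp (ContinuousLinearMap.snd ℝ _ _)))), fun Y => by
        simp⟩
  have hdec := hX.map_sub_le L (c := -couplingEnergy o Δ (X t).1 + C₁ * η) (mem_Ici.2 ht0)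
    (mem_Ici.2 ht1') (by linarith) fun r hr w hw => by
      have h1 := couplingEnergy_le_sum_inner o hΔ (hB t (mem_Ici.2 ht0)).relPos_le
        (hB r (mem_Ici.2 (ht0.trans hr.1))).relPos_le (hz r hr) hw
      have h2 : L (agentField leader f g h Λ (X r) (edgeInput o w))
          = ∑ i, inner ℝ (edgeInput o w i) (y i) := by
        rw [hL]
        refine Finset.sum_congr rfl fun i _ => ?_
        by_cases hi : i = leader
        · simp [hy, hi]
        · simp only [agentField, hi, if_false, D.A_toEuclideanLin i hi]
          rw [real_inner_comm]
      have h3 : ∑ i, inner ℝ (edgeInput o w i) (y i)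
          = -∑ e, inner ℝ (w e) (relPos o (X t).1 e) := by
        simp only [hy, inner_sub_right, Finset.sum_sub_distrib]
        rw [sum_inner_edgeInput_const, sum_inner_relPos]
        ring
      have h4 : Fintype.card G.edgeSet * (p * (2 * (B + Δ / 2) * (4 * η))) = C₁ * η := by
        rw [hC₁]; ring
      rw [h2, h3]
      linarith
  have hlow : -(C₂ * η) ≤ L (X (t + 1)) - L (X t) := by
    rw [hL, hL, ← Finset.sum_sub_distrib, hC₂, Finset.sum_mul, ← Finset.sum_neg_distrib]
    refine Finset.sum_le_sum fun i _ => ?_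
    rw [← inner_sub_right, ← map_sub]
    refine (neg_le_neg ?_).trans (neg_abs_le _)
    refine (abs_real_inner_le_norm _ _).trans ?_
    have h1 := (norm_le_pi_norm _ i).trans (ht1 (t + 1) (right_mem_Icc.2 (by linarith)))
    calc _ ≤ (N * B) * (‖D.A i‖ * η) := by
          gcongr
          · exact hyB i
          · exact ((D.A i).le_opNorm _).trans (by gcongr; exact h1)
      _ = _ := by ring
  rw [add_sub_cancel_left, mul_one] at hdec
  linarith

theorem tendsto_infDist_targetSet (hG : G.Connected) (D : LyapunovData leader f g h Λ)
    (hΔ : 0 < Δ)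
    (hf : ∀ i, Continuous (f i)) (hg : ∀ i, Continuous (g i)) (hh : ∀ i, Continuous (h i))
    (hf0 : ∀ i, f i 0 = 0) (hh0 : ∀ i, h i 0 = 0) (hg0 : ∀ i, Function.Injective (g i 0)) :
    Tendsto (fun t => Metric.infDist (X t) (targetSet n o Δ v)) atTop (𝓝 0) := by
  obtain ⟨B, hB⟩ := hX.exists_isBoundedState D hΔ
  have hB0 : 0 ≤ B := (norm_nonneg _).trans (hB 0 self_mem_Ici).relPos_le
  rw [Metric.tendsto_nhds]
  intro ε hε
  -- The last condition bounds the displacement `η / (Δ / 2 + η) * (N * B)` of the contraction below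
  -- by `ε`.
  obtain ⟨η, hη, hηε, hηB⟩ : ∃ η : ℝ, 0 < η ∧ η < ε ∧ η * (N * B) < ε * (Δ / 2) := by
    refine ⟨ε / 2 * (Δ / 2) / (N * B + Δ / 2), by positivity, ?_, ?_⟩
    · rw [div_lt_iff₀ (by positivity)]
      nlinarith [mul_pos hε hΔ, mul_nonneg hε.le (by positivity : 0 ≤ N * B)]
    · rw [div_mul_eq_mul_div, div_lt_iff₀ (by positivity)]
      nlinarith [mul_pos hε hΔ, mul_nonneg (mul_pos hε hΔ).le (by positivity : 0 ≤ N * B),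
        mul_pos (mul_pos hε hΔ) hΔ]
  filter_upwards [eventually_ge_atTop 0,
    hX.eventually_couplingEnergy_le hG D hΔ hf hg hh hf0 hh0 hg0 (mul_pos hΔ hη),
    Metric.tendsto_nhds.1 (hX.tendsto_agents D hΔ hf hg hh) η hη,
    Metric.tendsto_nhds.1 (hX.tendsto_velocity hG D hΔ hf hg hh hf0 hh0 hg0) η hη]
    with t ht0 ht1 ht2 ht3
  have hz : ∀ e j, |relPos o (X t).1 e j| ≤ Δ / 2 + η := by
    intro e j
    have h1 := (mul_abs_sub_le_quantizerPotential hΔ _).trans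
      ((quantizerPotential_le_couplingEnergy o hΔ (X t).1 e j).trans ht1)
    linarith [le_of_mul_le_mul_left h1 hΔ]
  have hden : 0 < Δ / 2 + η := by positivity
  -- Contracting the positions towards the leader by `l` scales every relative position by `l`,
  -- which takes the bound `Δ / 2 + η` to exactly `Δ / 2` and yields a nearby point of the target
  -- set.
  set l : ℝ := Δ / 2 / (Δ / 2 + η) with hl
  have hl0 : 0 ≤ l := by positivity
  have hl1 : 1 - l = η / (Δ / 2 + η) := by rw [hl]; field
  set x : Fin N → EuclideanSpace ℝ (Fin p) :=
    fun i => (X t).1 leader + l • ((X t).1 i - (X t).1 leader) with hx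
  have hmem : ((x, 0, fun _ => v) : State N p n) ∈ targetSet n o Δ v := by
    refine ⟨rfl, fun e j => ?_, rfl⟩
    have h1 : relPos o x e = l • relPos o (X t).1 e := by
      simp only [relPos_apply, hx, ← smul_sub, add_sub_add_left_eq_sub, sub_sub_sub_cancel_right]
    rw [mem_Icc, ← abs_le, h1, PiLp.smul_apply, smul_eq_mul, abs_mul, abs_of_nonneg hl0]
    calc l * |relPos o (X t).1 e j| ≤ l * (Δ / 2 + η) := by gcongr; exact hz e j
      _ = Δ / 2 := by rw [hl]; field
  have hdist : dist (X t).1 x < ε := by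
    refine (dist_pi_lt_iff hε).2 fun i => ?_
    have h1 : (X t).1 i - x i = (1 - l) • ((X t).1 i - (X t).1 leader) := by
      simp only [hx, sub_smul, one_smul]
      abel
    have h2 : ‖(X t).1 i - (X t).1 leader‖ ≤ N * B :=
      (norm_sub_le_mul_norm_relPos hG o _ i leader).trans (by
        gcongr
        exact (hB t (mem_Ici.2 ht0)).relPos_le)
    rw [dist_eq_norm, h1, norm_smul, hl1, Real.norm_of_nonneg (by positivity)]
    calc η / (Δ / 2 + η) * ‖(X t).1 i - (X t).1 leader‖ ≤ η / (Δ / 2 + η) * (N * B) := by gcongr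
      _ < ε := by
        rw [div_mul_eq_mul_div, div_lt_iff₀ hden]
        nlinarith
  rw [Real.dist_0_eq_abs, abs_of_nonneg Metric.infDist_nonneg]
  refine (Metric.infDist_le_dist_of_mem hmem).trans_lt ?_
  exact max_lt hdist (max_lt (ht2.trans hηε) (ht3.trans hηε))

theorem tendsto_velocity_sub (hG : G.Connected) (D : LyapunovData leader f g h Λ)
    (hΔ : 0 < Δ)
    (hf : ∀ i, Continuous (f i)) (hg : ∀ i, Continuous (g i)) (hh : ∀ i, Continuous (h i))
    (hf0 : ∀ i, f i 0 = 0) (hh0 : ∀ i, h i 0 = 0) (hg0 : ∀ i, Function.Injective (g i 0)) :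
    Tendsto (fun t => (fun i => h i ((X t).2.1 i) + (X t).2.2 i) - fun _ => v) atTop (𝓝 0) := by
  refine tendsto_pi_nhds.2 fun i => ?_
  have h1 : Tendsto (fun t => (X t).2.1 i) atTop (𝓝 0) :=
    (tendsto_pi_nhds.1 (hX.tendsto_agents D hΔ hf hg hh)) i
  have h2 := (tendsto_pi_nhds.1 (hX.tendsto_velocity hG D hΔ hf hg hh hf0 hh0 hg0)) i
  have h3 := ((((hh i).tendsto 0).comp h1).add h2).sub_const v
  simpa [hh0] using h3

end IsSelectionSolution

end Convergence

end QuantizedCoordination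

theorem mainTheorem4 {N p : ℕ} (n : Fin N → ℕ)
    (G : SimpleGraph (Fin N)) [Fintype G.edgeSet] (hG : G.Connected)
    (o : QuantizedCoordination.EdgeOrientation G) (leader : Fin N)
    (f : (i : Fin N) → EuclideanSpace ℝ (Fin (n i)) → EuclideanSpace ℝ (Fin (n i)))
    (g : (i : Fin N) → EuclideanSpace ℝ (Fin (n i)) →
      (EuclideanSpace ℝ (Fin p) →L[ℝ] EuclideanSpace ℝ (Fin (n i))))
    (h : (i : Fin N) → EuclideanSpace ℝ (Fin (n i)) → EuclideanSpace ℝ (Fin p))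
    (hreg : ∀ i, QuantizedCoordination.RegularAgent (f i) (g i) (h i))
    (hpass : ∀ i, QuantizedCoordination.StrictlyPassive (f i) (g i) (h i))
    (Λ : Fin N → Matrix (Fin p) (Fin p) ℝ) (hΛ : ∀ i, i ≠ leader → (Λ i).PosDef)
    (v : EuclideanSpace ℝ (Fin p)) (Δ : ℝ) (hΔ : 0 < Δ)
    (X : ℝ → QuantizedCoordination.State N p n) (I : Set ℝ)
    (hX : QuantizedCoordination.IsMaximalKrasovskiiSolution
      (QuantizedCoordination.closedLoop o leader Δ f g h Λ) X I)
    (hlead : (X 0).2.2 leader = v) :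
    I = Ici 0 ∧
    Tendsto (fun t => Metric.infDist (X t) (QuantizedCoordination.targetSet n o Δ v))
      atTop (𝓝 0) ∧
    ∃ x' : ℝ → Fin N → EuclideanSpace ℝ (Fin p),
      (∀ t, 0 < t → HasDerivAt (fun s => (X s).1) (x' t) t) ∧
      Tendsto (fun t => x' t - fun _ => v) atTop (𝓝 0) := by
  obtain ⟨D⟩ := QuantizedCoordination.nonempty_lyapunovData hpass hΛ
  have hf : ∀ i, Continuous (f i) := fun i => (hreg i).1.continuous
  have hg : ∀ i, Continuous (g i) := fun i => (hreg i).2.1.continuous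
  have hh : ∀ i, Continuous (h i) := fun i => (hreg i).2.2.1.continuous
  have hf0 : ∀ i, f i 0 = 0 := fun i => (hreg i).2.2.2.1
  have hh0 : ∀ i, h i 0 = 0 := fun i => (hreg i).2.2.2.2.1
  have hg0 : ∀ i, Function.Injective (g i 0) := fun i => (hreg i).2.2.2.2.2
  have hsol := hX.isSelectionSolution hΔ hf hg hh hlead
  obtain ⟨K, hK⟩ := hsol.exists_lipschitzOnWith D hΔ hf hg hh
  have hI : I = Ici 0 :=
    hX.eq_Ici (QuantizedCoordination.closedLoop_locally_bounded hΔ hf hg hh o) hK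
  subst hI
  exact ⟨rfl, hsol.tendsto_infDist_targetSet hG D hΔ hf hg hh hf0 hh0 hg0, _,
    fun t ht => hsol.hasDerivAt_fst hh ht, hsol.tendsto_velocity_sub hG D hΔ hf hg hh hf0 hh0 hg0⟩
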